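/- **Conventions.** For a permutation $\sigma\in S_N$ put $\Delta_N^+=\{(i,j)\mid 1\le i<j\le N\}$ and $\Phi(\sigma)=\{(i,j)\in\Delta_N^+\mid \sigma(i)>\sigma(j)\}$; $w_0\in S_N$ is the permutation $i\mapsto N+1-i$. If $\sigma_0\in S_m$ and $\beta_b\in S_{z_b}$ with $z_b\ge 1$ ($1\le b\le m$), the inflation $\sigma_0[\beta_1,\dots,\beta_m]\in S_{z_1+\dots+z_m}$ is obtained by cutting $\{1,\dots,z_1+\dots+z_m\}$ into consecutive intervals $I_1<\dots<I_m$ of sizes $z_1,\dots,z_m$, permuting inside $I_b$ according to $\beta_b$ and permuting the intervals according to $\sigma_0$. A permutation is *minus-decomposable* if it equals $w_0[\alpha,\beta]$ with $w_0\in S_2$, and *minus-indecomposable* otherwise. Let $\Delta_{B_n}^+=\{\varepsilon_i\pm\varepsilon_j\mid 1\le i<j\le n\}\cup\{\varepsilon_i\mid 1\le i\le n\}$. Put $\varepsilon_{n+1}=0$ and $\varepsilon_{2n+2-i}=-\varepsilon_i$. The group $W(B_n)$ consists of the permutations $\sigma$ of $\{\varepsilon_1,\dots,\varepsilon_{2n+1}\}$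 with $\sigma(0)=0$ and $\sigma(-x)=-\sigma(x)$, acting linearly on roots, and $\Phi(\sigma)=\{v\in\Delta_{B_n}^+\mid -\sigma(v)\in\Delta_{B_n}^+\}$. It embeds in $S_{2n+1}$ by $\sigma\mapsto\tilde\sigma$, where $\tilde\sigma(i)=k$ if $\sigma(\varepsilon_i)=\varepsilon_k$. An element $w\in W(B_n)$ is called minus-decomposable if $\tilde w$ is. An element $\sigma\in W(B_n)$ is *$W(B_n)$-simple* if every expression $\tilde\sigma=\tilde\sigma_0[\tau_1,\dots,\tau_{2s+1}]$ with $\sigma_0\in W(B_s)$ and $\tau_{2s+2-t}=w_0\tau_tw_0$ for all $t$ has $s=0$ or $s=n$. In $S_N$ (resp. $W(B_n)$), an element $\sigma$ is *irreducible* if, whenever $\Phi(\sigma)=\Phi(\sigma_1)\sqcup\dots\sqcup\Phi(\sigma_k)$ with $k\ge1$ and all $\sigma_a$ in $S_N$ (resp. $W(B_n)$), some $\Phi(\sigma_a)$ equals $\Phi(\sigma)$. (The identity is irreducible.) A decomposition into inversion sets is irreducible if all its members are. **Theorem.** Let $n\ge 1$ and let $\Delta_{B_n}^+=\Phi(w_1)\sqcup\dots\sqcup\Phi(w_r)$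 with $w_a\in W(B_n)$ and all $\Phi(w_a)\ne\emptyset$ (so $r\ge1$). Then, after possibly reordering, there are $s\ge1$, $\sigma_1,\dots,\sigma_r\in W(B_s)$, sizes $z_1,\dots,z_{2s+1}\ge1$, permutations $\beta_{ab}\in S_{z_b}$ and an integer $q$ such that, for all $a=1,\dots,r$, $$\tilde w_a=\tilde\sigma_a[\beta_{a1},\beta_{a2},\dots,\beta_{a(2s+1)}],\qquad \beta_{at}=w_0\,\beta_{a(2s+2-t)}\,w_0\quad(1\le t\le 2s+1),$$ $$(\dagger)\qquad \Phi(\beta_{1b})\sqcup\dots\sqcup\Phi(\beta_{rb})=\Delta_{z_b}^+\quad\text{for all } b=1,\dots,2s+1,$$ $\sigma_q=\sigma_{q+1}=\dots=\sigma_r=\mathrm{Id}$, and * $\tilde\sigma_1=w_0$ and $q=2$, if $w_1$ is minus-decomposable; * $s\ge2$, $r\ge2$, $\sigma_1$ is $W(B_s)$-simple, $\tilde\sigma_2=w_0\tilde\sigma_1$ and $q=3$, if $w_1$ is minus-indecomposable. Moreover, for every reordering and every choice of data as above, the decomposition of $\Delta_{B_n}^+$ is irreducible if and only if all of the following hold: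 * for every $b\ne s+1$ the decomposition $(\dagger)$ is irreducible in $S_{z_b}$, and for $b=s+1$ the decomposition $(\dagger)$, whose members come from $W(B_k)$ with $z_{s+1}=2k+1$, is irreducible in $W(B_k)$; * for each $a=q,q+1,\dots,r$ exactly one of $\beta_{a1},\dots,\beta_{a(s+1)}$ is not the identity; * if $w_1$ is minus-decomposable, then $s=1$ and $\beta_{11}=\beta_{12}=\beta_{13}=\mathrm{Id}$; if $w_1$ is minus-indecomposable, then $\beta_{1b}=\beta_{2b}=\mathrm{Id}$ for all $b=1,\dots,2s+1$. -/

import Mathlib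

/-! ### Families of sets and type `A` -/

/-- `S` is the disjoint union of the finite family `F` (some members may be empty). -/
def IsDisjointUnion {X : Type*} {r : ℕ} (S : Set X) (F : Fin r → Set X) : Prop :=
  Pairwise (fun a b => Disjoint (F a) (F b)) ∧ ⋃ a, F a = S

/-- The longest element `(N, N-1, …, 1)` of the symmetric group on `N` letters. -/
def longest (N : ℕ) : Equiv.Perm (Fin N) := Fin.revPerm

/-- The positive roots `(i, j) = e_i - e_j`, `i < j`, attached to the symmetric group on `N`
letters (the root system of type `A_{N-1}`). -/
def posRootsA (N : ℕ) : Set (Fin N × Fin N) := {p | p.1 < p.2}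

/-- The inversion set of a permutation. -/
def invA {N : ℕ} (σ : Equiv.Perm (Fin N)) : Set (Fin N × Fin N) :=
  {p ∈ posRootsA N | σ p.2 < σ p.1}

/-- A permutation is irreducible if every decomposition of its inversion set into (one or more)
inversion sets is trivial, i.e. has the whole inversion set as one of its members. -/
def IrreducibleA {N : ℕ} (σ : Equiv.Perm (Fin N)) : Prop :=
  ∀ (k : ℕ) (γ : Fin (k + 1) → Equiv.Perm (Fin N)),
    IsDisjointUnion (invA σ) (fun a => invA (γ a)) → ∃ a, invA (γ a) = invA σ

/-- The inflation `σ₀[β_1, …, β_m]` of `σ₀`: cut `∑ z_b` cards into consecutive piles of sizes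
`z_1, …, z_m`, shuffle the `b`-th pile by `β_b`, and reassemble the piles in the order given by
`σ₀`, the `b`-th pile becoming the `σ₀(b)`-th one. -/
def inflate {m : ℕ} (σ₀ : Equiv.Perm (Fin m)) (z : Fin m → ℕ)
    (β : ∀ b, Equiv.Perm (Fin (z b))) : Equiv.Perm (Fin (∑ b, z b)) :=
  (finSigmaFinEquiv (n := z)).symm.trans <|
    (Equiv.sigmaCongr (β₂ := fun c => Fin (z (σ₀.symm c))) σ₀
      (fun b => (β b).trans (finCongr (by rw [Equiv.symm_apply_apply])))).trans <|
    (finSigmaFinEquiv (n := fun c => z (σ₀.symm c))).trans <|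
    finCongr (Equiv.sum_comp σ₀.symm z)

/-- The permutation `w` of `N` letters is the inflation `σ₀[β_1, …, β_m]`, over a division of the
`N` letters into `m` non-empty intervals of sizes `z_1, …, z_m`. -/
def IsInflation {N m : ℕ} (w : Equiv.Perm (Fin N)) (σ₀ : Equiv.Perm (Fin m)) (z : Fin m → ℕ)
    (β : ∀ b, Equiv.Perm (Fin (z b))) : Prop :=
  (∀ b, 0 < z b) ∧ ∃ h : ∑ b, z b = N, w = (finCongr h).permCongr (inflate σ₀ z β)

/-- `w` is minus-decomposable if it has the form `w₀[α, β]` with `w₀` the transposition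
of two letters. -/
def MinusDecomposable {N : ℕ} (w : Equiv.Perm (Fin N)) : Prop :=
  ∃ (z : Fin 2 → ℕ) (β : ∀ b, Equiv.Perm (Fin (z b))), IsInflation w (longest 2) z β

/-- The family `β_1, …, β_m` is symmetric: `β_{m+1-t} = w₀ β_t w₀` for all `t` (in particular the
sizes agree, `z_{m+1-t} = z_t`). -/
def IsSymmetricFamily {m : ℕ} (z : Fin m → ℕ) (β : ∀ b, Equiv.Perm (Fin (z b))) : Prop :=
  ∃ hz : ∀ b, z b = z b.rev,
    ∀ b, β b.rev = (finCongr (hz b)).permCongr (longest (z b) * β b * longest (z b))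

/-! ### Type `B` -/

/-- The vectors `ε_1, …, ε_n, ε_{n+1} = 0, ε_{n+2} = -ε_n, …, ε_{2n+1} = -ε_1` of `ℤⁿ`, where
`ε_1, …, ε_n` is the standard basis; the index `k : Fin (2n+1)` stands for `ε_{k+1}`. -/
def eps (n : ℕ) (k : Fin (2 * n + 1)) : Fin n → ℤ :=
  fun i => (if (k : ℕ) = i then 1 else 0) - (if (k : ℕ) + i = 2 * n then 1 else 0)

theorem eps_injective (n : ℕ) : Function.Injective (eps n) := by
  have key : ∀ k l : Fin (2 * n + 1), eps n k = eps n l → (k : ℕ) < n → k = l := by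
    intro k l h hk
    have h1 := congrFun h ⟨k, hk⟩
    simp only [eps] at h1
    apply Fin.ext
    have := l.2
    split_ifs at h1 <;> omega
  have key2 : ∀ k l : Fin (2 * n + 1), eps n k = eps n l → n < (k : ℕ) → k = l := by
    intro k l h hk
    have h0 := k.2
    have h1 := congrFun h ⟨2 * n - k, by omega⟩
    simp only [eps] at h1
    apply Fin.ext
    have := l.2
    split_ifs at h1 <;> omega
  intro k l h
  rcases lt_trichotomy (k : ℕ) n with hk | hk | hk
  · exact key k l h hk
  · rcases lt_trichotomy (l : ℕ) n with hl | hl | hl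
    · exact (key l k h.symm hl).symm
    · exact Fin.ext (hk.trans hl.symm)
    · exact (key2 l k h.symm hl).symm
  · exact key2 k l h hk

/-- The set `{ε_1, …, ε_n, 0, -ε_n, …, -ε_1}`. -/
abbrev signedVectors (n : ℕ) : Set (Fin n → ℤ) := Set.range (eps n)

/-- The Weyl group of type `B_n`: the signed permutations of `{ε_1, …, ε_n, 0, -ε_n, …, -ε_1}`,
i.e. those with `σ(0) = 0` and `σ(-x) = -σ(x)`. (The set contains `0` and is stable under negation,
so for a bijection `σ` the two equivalences below say exactly this.) -/
def WeylB (n : ℕ) : Subgroup (Equiv.Perm (signedVectors n)) where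
  carrier := {σ | (∀ x : signedVectors n, (x : Fin n → ℤ) = 0 ↔ (σ x : Fin n → ℤ) = 0) ∧
    ∀ x y : signedVectors n, (y : Fin n → ℤ) = -x ↔ (σ y : Fin n → ℤ) = -(σ x)}
  mul_mem' := by
    intro a b ha hb
    refine ⟨fun x => ?_, fun x y => ?_⟩
    · rw [Equiv.Perm.mul_apply, ← ha.1, ← hb.1]
    · rw [Equiv.Perm.mul_apply, Equiv.Perm.mul_apply, ← ha.2, ← hb.2]
  one_mem' := ⟨fun _ => Iff.rfl, fun _ _ => Iff.rfl⟩
  inv_mem' := by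
    intro a ha
    have h : ∀ x, a (a⁻¹ x) = x := fun x => a.apply_symm_apply x
    refine ⟨fun x => ?_, fun x y => ?_⟩
    · rw [ha.1 (a⁻¹ x), h]
    · rw [ha.2 (a⁻¹ x) (a⁻¹ y), h, h]

/-- The embedding `σ ↦ σ̃` of `W(B_n)` into the symmetric group on `2n+1` letters:
`σ̃(i) = k` if `σ(ε_i) = ε_k`. -/
noncomputable def tilde {n : ℕ} : WeylB n →* Equiv.Perm (Fin (2 * n + 1)) :=
  ((Equiv.ofInjective (eps n) (eps_injective n)).symm.permCongrHom).toMonoidHom.comp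
    (WeylB n).subtype

/-- The positive roots `ε_i - ε_j` and `ε_i + ε_j` (`i < j`) and `ε_i` of type `B_n`. -/
def posRootsB (n : ℕ) : Set (Fin n → ℤ) :=
  {v | (∃ i j, i < j ∧ v = Pi.single i 1 - Pi.single j 1) ∨
    (∃ i j, i < j ∧ v = Pi.single i 1 + Pi.single j 1) ∨ ∃ i, v = Pi.single i 1}

/-- The linear action of `W(B_n)` on `ℤⁿ`: `σ · ∑ v_i ε_i = ∑ v_i σ(ε_i)`. -/
def actB {n : ℕ} (σ : WeylB n) (v : Fin n → ℤ) : Fin n → ℤ :=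
  ∑ i : Fin n, v i • ((σ : Equiv.Perm (signedVectors n))
    ⟨eps n (Fin.castLE (by omega) i), Set.mem_range_self _⟩ : Fin n → ℤ)

/-- The inversion set of `σ ∈ W(B_n)`: the positive roots that `σ` makes negative. -/
def invB {n : ℕ} (σ : WeylB n) : Set (Fin n → ℤ) :=
  {v ∈ posRootsB n | -(actB σ v) ∈ posRootsB n}

/-- An element of `W(B_n)` is irreducible if every decomposition of its inversion set into (one or
more) inversion sets of elements of `W(B_n)` is trivial. -/
def IrreducibleB {n : ℕ} (σ : WeylB n) : Prop :=
  ∀ (k : ℕ) (γ : Fin (k + 1) → WeylB n),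
    IsDisjointUnion (invB σ) (fun a => invB (γ a)) → ∃ a, invB (γ a) = invB σ

/-- `σ ∈ W(B_n)` is simple in `W(B_n)`: it is not a symmetric inflation, over `2s+1` intervals, of
an element of `W(B_s)`, except with `s = 0` or `s = n`. -/
def IsSimpleB {n : ℕ} (σ : WeylB n) : Prop :=
  ∀ (s : ℕ) (σ₀ : WeylB s) (z : Fin (2 * s + 1) → ℕ) (β : ∀ b, Equiv.Perm (Fin (z b))),
    IsInflation (tilde σ) (tilde σ₀) z β → IsSymmetricFamily z β → s = 0 ∨ s = n

/-- A permutation of `N` letters is irreducible as an element of a Weyl group of type `B`: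
`N = 2k+1` and it is `τ̃` for an irreducible `τ ∈ W(B_k)`. -/
def IrreducibleSymmetric {N : ℕ} (β : Equiv.Perm (Fin N)) : Prop :=
  ∃ (k : ℕ) (h : N = 2 * k + 1) (τ : WeylB k),
    (finCongr h).permCongr β = tilde τ ∧ IrreducibleB τ

/-- The inflation form of a family `w_1, …, w_r` of elements of `W(B_n)` (numbered from `0` in the
code): `w̃_a = σ̃_a[β_{a1}, …, β_{a(2s+1)}]` with symmetric families of pieces. -/
structure IsInflationForm {n r s : ℕ} (hr : 0 < r) (w : Fin r → WeylB n) (q : ℕ)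
    (σ : Fin r → WeylB s) (z : Fin (2 * s + 1) → ℕ)
    (β : Fin r → ∀ b, Equiv.Perm (Fin (z b))) : Prop where
  one_le : 1 ≤ s
  inflation : ∀ a, IsInflation (tilde (w a)) (tilde (σ a)) z (β a)
  symmetric : ∀ a, IsSymmetricFamily z (β a)
  pieces : ∀ b, IsDisjointUnion (posRootsA (z b)) (fun a => invA (β a b))
  identity : ∀ a : Fin r, q ≤ (a : ℕ) + 1 → σ a = 1
  minus_decomposable : MinusDecomposable (tilde (w ⟨0, hr⟩)) →
    tilde (σ ⟨0, hr⟩) = longest (2 * s + 1) ∧ q = 2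
  minus_indecomposable : ¬ MinusDecomposable (tilde (w ⟨0, hr⟩)) →
    2 ≤ s ∧ IsSimpleB (σ ⟨0, hr⟩) ∧
      (∃ h : 1 < r, tilde (σ ⟨1, h⟩) = longest (2 * s + 1) * tilde (σ ⟨0, hr⟩)) ∧ q = 3

/-- The conditions on an inflation form that characterize irreducible decompositions. The middle
pieces (`b = s+1`, which is the value `s` of `Fin (2s+1)`) are symmetric permutations and are
irreducible in the sense of type `B`, the other pieces in the sense of type `A`. -/
structure IrreducibilityCriterion {n r s : ℕ} (hr : 0 < r) (w : Fin r → WeylB n) (q : ℕ)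
    (z : Fin (2 * s + 1) → ℕ) (β : Fin r → ∀ b, Equiv.Perm (Fin (z b))) : Prop where
  outer : ∀ (a : Fin r) (b : Fin (2 * s + 1)), (b : ℕ) ≠ s → IrreducibleA (β a b)
  middle : ∀ (a : Fin r) (b : Fin (2 * s + 1)), (b : ℕ) = s → IrreducibleSymmetric (β a b)
  exactly_one : ∀ a : Fin r, q ≤ (a : ℕ) + 1 →
    ∃! b : Fin (2 * s + 1), (b : ℕ) ≤ s ∧ β a b ≠ 1
  minus_decomposable : MinusDecomposable (tilde (w ⟨0, hr⟩)) →
    s = 1 ∧ ∀ b, β ⟨0, hr⟩ b = 1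
  minus_indecomposable : ¬ MinusDecomposable (tilde (w ⟨0, hr⟩)) →
    ∀ a : Fin r, (a : ℕ) < 2 → ∀ b, β a b = 1

namespace InversionDecomposition

open Equiv Function

/-! ### Permutations and their inversion sets -/

/-! Reading a root of type `B_n` as a pair of letters `x < y` among `2n+1`, up to `(x, y) ↦ (y.rev,
x.rev)`, turns `invB σ` into the inversion set of `tilde σ`, and the permutations `tilde σ` are
exactly those commuting with the reversal. The theorem becomes a statement about symmetric
permutations.

A decomposition of an inversion set is an edge colouring of the complete graph on the letters, with
the extra value `none` on non-inverted pairs. Since inversions and non-inversions are both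
transitive, for `x < y < z` the side `xz` has the colour of `xy` or of `yz`. Hence no triangle is
rainbow, and Gallai's argument applies (`not_three_connected`): if three values occur, the graph of
one of them is disconnected. Its components are homogeneous, and the order condition makes them
intervals (`IsColoring.exists_nontrivial`).

For the set of all pairs there are two cases. If some member is minus-decomposable, its colour fills
a cut and the mirror cut, which gives three blocks with a single colour between them. Otherwise no
cut is monochromatic, so the maximal proper homogeneous intervals form a division
(`exists_maximal_homogeneous`). The quotient has only trivial homogeneous divisions, so by Gallai it
uses at most two colours, and exactly two because one colour would give a monochromatic cut
(`exists_prime_quotient`). These two colours are a simple `σ_1` and its complement `w₀σ_1`.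

For the criterion, an inflation `σ[β]` splits as `σ[1]` and `1[β]`, and `1[β]` splits further along
the pairs of mirror blocks, so an irreducible member lives in one place only. Conversely, a
decomposition of `1[β]` concentrated on one such pair is determined by a single block. Inflating by
trivial blocks preserves irreducibility (`SymmIrreducible.inflate`), and simple elements are
irreducible by Gallai once more (`HasTrivialBlocks.symmIrreducible`). -/

theorem isDisjointUnion_iff {X : Type*} {r : ℕ} {S : Set X} {F : Fin r → Set X} :
    IsDisjointUnion S F ↔ (∀ x, x ∈ S ↔ ∃ a, x ∈ F a) ∧ ∀ x a b, x ∈ F a → x ∈ F b → a = b := by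
  constructor
  · rintro ⟨hd, hu⟩
    refine ⟨fun x => by rw [← hu, Set.mem_iUnion], fun x a b ha hb => ?_⟩
    by_contra hab
    exact Set.disjoint_left.1 (hd hab) ha hb
  · rintro ⟨hu, hd⟩
    refine ⟨fun a b hab => Set.disjoint_left.2 fun x ha hb => hab (hd x a b ha hb), ?_⟩
    ext x
    rw [Set.mem_iUnion, hu]

theorem mem_invA {N : ℕ} {w : Perm (Fin N)} {x y : Fin N} :
    (x, y) ∈ invA w ↔ x < y ∧ w y < w x := Iff.rfl

theorem mem_posRootsA {N : ℕ} {x y : Fin N} : (x, y) ∈ posRootsA N ↔ x < y := Iff.rfl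

/-- Recurring device: two order-preserving enumerations of the same letters are compared by a
strictly increasing self-map, which must then be the identity. -/
theorem strictMono_fin_eq_id {N : ℕ} {g : Fin N → Fin N} (hg : StrictMono g) : g = id :=
  (hg.range_inj strictMono_id).1 (by
    rw [(Finite.surjective_of_injective hg.injective).range_eq, Set.range_id])

/-- The map `w' ∘ w⁻¹` is increasing, hence the identity. This allows every identity between
permutations to be checked on comparisons of values, without computing any value. -/
theorem perm_ext_of_lt {N : ℕ} {w w' : Perm (Fin N)} (h : ∀ x y, w x < w y → w' x < w' y) :
    w = w' := by
  have h1 : StrictMono (w.symm.trans w') := fun x y hxy => h _ _ (by simpa using hxy)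
  have h2 := strictMono_fin_eq_id h1
  ext x
  have := congrFun h2 (w x)
  simp at this
  rw [this]

theorem lt_iff_not_lt {N : ℕ} (w : Perm (Fin N)) {x y : Fin N} (h : x ≠ y) :
    w x < w y ↔ ¬ w y < w x := by
  have : w x ≠ w y := fun e => h (w.injective e)
  constructor
  · exact fun h => h.asymm
  · intro h'
    exact lt_of_le_of_ne (not_lt.1 h') this

theorem invA_injective {N : ℕ} : Injective (invA (N := N)) := by
  intro w w' h
  apply perm_ext_of_lt
  intro x y hxy
  have hne : x ≠ y := by rintro rfl; exact lt_irrefl _ hxy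
  rcases lt_or_gt_of_ne hne with hlt | hlt
  · have h1 : (x, y) ∉ invA w := fun hm => hxy.asymm hm.2
    rw [h, mem_invA] at h1
    rw [lt_iff_not_lt _ hne]
    tauto
  · have h1 : (y, x) ∈ invA w := ⟨hlt, hxy⟩
    rw [h] at h1
    exact h1.2

theorem invA_one (N : ℕ) : invA (1 : Perm (Fin N)) = ∅ := by
  ext ⟨x, y⟩
  simp only [mem_invA, Perm.coe_one, id, Set.mem_empty_iff_false, iff_false, not_and]
  exact fun h => h.asymm

theorem longest_apply {N : ℕ} (x : Fin N) : longest N x = x.rev := rfl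

theorem invA_longest (N : ℕ) : invA (longest N) = posRootsA N := by
  ext ⟨x, y⟩
  simp only [mem_invA, longest_apply, Fin.rev_lt_rev, mem_posRootsA, and_self]

/-- Standardization: the inverse of the sorting permutation ranks the values of `f`. It produces the
pieces `β_b` and the block permutation `σ` of an inflation. -/
theorem exists_perm_lt {m : ℕ} {α : Type*} [LinearOrder α] (f : Fin m → α) (hf : Injective f) :
    ∃ τ : Perm (Fin m), ∀ i j, τ i < τ j ↔ f i < f j := by
  have hm : StrictMono (f ∘ Tuple.sort f) :=
    (Tuple.monotone_sort f).strictMono_of_injective (hf.comp (Tuple.sort f).injective)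
  refine ⟨(Tuple.sort f)⁻¹, fun i j => ?_⟩
  rw [← hm.lt_iff_lt]
  simp

/-- The permutation commutes with the reversal of the letters. -/
def IsSymm {N : ℕ} (w : Perm (Fin N)) : Prop := ∀ x, w x.rev = (w x).rev

theorem isSymm_one {N : ℕ} : IsSymm (1 : Perm (Fin N)) := fun _ => rfl

theorem isSymm_longest {N : ℕ} : IsSymm (longest N) := fun _ => rfl

theorem IsSymm.mul {N : ℕ} {v w : Perm (Fin N)} (hv : IsSymm v) (hw : IsSymm w) :
    IsSymm (v * w) := fun x => by
  rw [Perm.mul_apply, Perm.mul_apply, hw, hv]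

theorem isSymm_of_lt {N : ℕ} {w : Perm (Fin N)}
    (h : ∀ x y, w x < w y → w y.rev < w x.rev) : IsSymm w := by
  have h1 : w = longest N * w * longest N := by
    apply perm_ext_of_lt
    intro x y hxy
    simp only [Perm.mul_apply, longest_apply, Fin.rev_lt_rev]
    exact h x y hxy
  intro x
  conv_lhs => rw [h1]
  simp [longest_apply]

theorem IsSymm.lt_iff {N : ℕ} {w : Perm (Fin N)} (hw : IsSymm w) (x y : Fin N) :
    w y.rev < w x.rev ↔ w x < w y := by
  rw [hw, hw, Fin.rev_lt_rev]

theorem IsSymm.mem_invA {N : ℕ} {w : Perm (Fin N)} (hw : IsSymm w) (x y : Fin N) :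
    (y.rev, x.rev) ∈ invA w ↔ (x, y) ∈ invA w := by
  rw [InversionDecomposition.mem_invA, InversionDecomposition.mem_invA, hw.lt_iff, Fin.rev_lt_rev]

/-! ### Blocks and inflations -/

/-- The embedding of the `b`-th block of a division into consecutive intervals. -/
def blockEmb {N m : ℕ} (z : Fin m → ℕ) (h : ∑ b, z b = N) (b : Fin m) (i : Fin (z b)) : Fin N :=
  finCongr h (finSigmaFinEquiv ⟨b, i⟩)

section blocks

variable {N m : ℕ} {z : Fin m → ℕ} {h : ∑ b, z b = N}

theorem finSigmaFinEquiv_lt_of_lt {m : ℕ} {z : Fin m → ℕ} {b b' : Fin m} (hb : b < b')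
    (i : Fin (z b)) (j : Fin (z b')) :
    finSigmaFinEquiv (⟨b, i⟩ : Σ b, Fin (z b)) < finSigmaFinEquiv ⟨b', j⟩ := by
  rw [Fin.lt_def, finSigmaFinEquiv_apply, finSigmaFinEquiv_apply]
  have key : ∀ k : Fin m, ∑ i : Fin (k : ℕ), z (Fin.castLE k.2.le i) =
      ∑ j ∈ Finset.univ.filter (fun j : Fin m => j < k), z j := by
    intro k
    refine Finset.sum_bij (fun i _ => Fin.castLE k.2.le i) ?_ ?_ ?_ ?_
    · exact fun i _ => Finset.mem_filter.2 ⟨Finset.mem_univ _, i.2⟩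
    · simp
    · intro j hj
      exact ⟨⟨j, by simpa using hj⟩, by simp, rfl⟩
    · simp
  simp only [key]
  have hsub : insert b (Finset.univ.filter (fun j : Fin m => j < b)) ⊆
      Finset.univ.filter (fun j : Fin m => j < b') := by
    intro x hx
    simp only [Finset.mem_insert, Finset.mem_filter, Finset.mem_univ, true_and] at hx ⊢
    rcases hx with rfl | hx
    · exact hb
    · exact hx.trans hb
  have h1 := Finset.sum_le_sum_of_subset (f := z) hsub
  rw [Finset.sum_insert (by simp)] at h1
  have := i.2
  omega

theorem finSigmaFinEquiv_lt_iff {m : ℕ} {z : Fin m → ℕ} {b : Fin m} (i j : Fin (z b)) :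
    finSigmaFinEquiv (⟨b, i⟩ : Σ b, Fin (z b)) < finSigmaFinEquiv ⟨b, j⟩ ↔ i < j := by
  rw [Fin.lt_def, finSigmaFinEquiv_apply, finSigmaFinEquiv_apply, Fin.lt_def]
  exact Nat.add_lt_add_iff_left

theorem blockEmb_lt_of_lt {b b' : Fin m} (hb : b < b') (i : Fin (z b)) (j : Fin (z b')) :
    blockEmb z h b i < blockEmb z h b' j :=
  finSigmaFinEquiv_lt_of_lt hb i j

theorem blockEmb_lt_iff {b : Fin m} (i j : Fin (z b)) :
    blockEmb z h b i < blockEmb z h b j ↔ i < j :=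
  finSigmaFinEquiv_lt_iff i j

theorem blockEmb_lt_iff_of_ne {b b' : Fin m} (hb : b ≠ b') (i : Fin (z b)) (j : Fin (z b')) :
    blockEmb z h b i < blockEmb z h b' j ↔ b < b' := by
  refine ⟨fun hlt => ?_, fun hlt => blockEmb_lt_of_lt hlt i j⟩
  by_contra hb'
  exact hlt.asymm (blockEmb_lt_of_lt (lt_of_le_of_ne (not_lt.1 hb') hb.symm) j i)

theorem exists_blockEmb (z : Fin m → ℕ) (h : ∑ b, z b = N) (x : Fin N) :
    ∃ b i, x = blockEmb z h b i := by
  refine ⟨(finSigmaFinEquiv.symm ((finCongr h).symm x)).1,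
    (finSigmaFinEquiv.symm ((finCongr h).symm x)).2, ?_⟩
  simp [blockEmb]

theorem blockEmb_injective (b : Fin m) : Injective (blockEmb z h b) :=
  StrictMono.injective fun i j hij => (blockEmb_lt_iff i j).2 hij

theorem blockEmb_ne {b b' : Fin m} (hb : b ≠ b') (i : Fin (z b)) (j : Fin (z b')) :
    blockEmb z h b i ≠ blockEmb z h b' j := by
  intro e
  rcases lt_or_gt_of_ne hb with hlt | hlt
  · exact (blockEmb_lt_of_lt hlt i j).ne e
  · exact (blockEmb_lt_of_lt hlt j i).ne e.symm

/-- `w` is the inflation `σ[β]`, in terms of comparisons of values. -/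
structure IsInfl (z : Fin m → ℕ) (h : ∑ b, z b = N) (w : Perm (Fin N)) (σ : Perm (Fin m))
    (β : ∀ b, Perm (Fin (z b))) : Prop where
  same : ∀ b i j, w (blockEmb z h b i) < w (blockEmb z h b j) ↔ β b i < β b j
  ne : ∀ b b' i j, b ≠ b' → (w (blockEmb z h b i) < w (blockEmb z h b' j) ↔ σ b < σ b')

theorem inflate_apply {m : ℕ} (σ : Perm (Fin m)) (z : Fin m → ℕ) (β : ∀ b, Perm (Fin (z b)))
    (b : Fin m) (i : Fin (z b)) :
    inflate σ z β (finSigmaFinEquiv ⟨b, i⟩) = finCongr (Equiv.sum_comp σ.symm z)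
      (finSigmaFinEquiv (⟨σ b, finCongr (by rw [Equiv.symm_apply_apply]) (β b i)⟩ :
        Σ c, Fin (z (σ.symm c)))) := by
  simp [inflate, Equiv.sigmaCongr]

theorem isInfl_inflate (σ : Perm (Fin m)) (β : ∀ b, Perm (Fin (z b))) :
    IsInfl z h ((finCongr h).permCongr (inflate σ z β)) σ β := by
  subst h
  constructor
  · intro b i j
    have := fun i => inflate_apply σ z β b i
    simp only [blockEmb, finCongr_refl, Equiv.refl_apply, Equiv.permCongr_apply, Equiv.refl_symm,
      this]
    exact finSigmaFinEquiv_lt_iff (z := fun c => z (σ.symm c)) _ _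
  · intro b b' i j hb
    simp only [blockEmb, finCongr_refl, Equiv.refl_apply, Equiv.permCongr_apply, Equiv.refl_symm,
      inflate_apply]
    have hσ : σ b ≠ σ b' := fun e => hb (σ.injective e)
    constructor
    · intro hlt
      by_contra hc
      have hgt : σ b' < σ b := lt_of_le_of_ne (not_lt.1 hc) hσ.symm
      exact hlt.asymm (finSigmaFinEquiv_lt_of_lt (z := fun c => z (σ.symm c)) hgt _ _)
    · intro hlt
      exact finSigmaFinEquiv_lt_of_lt (z := fun c => z (σ.symm c)) hlt _ _

variable {w : Perm (Fin N)} {σ : Perm (Fin m)} {β : ∀ b, Perm (Fin (z b))}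

theorem IsInfl.ext {w' : Perm (Fin N)} (hw : IsInfl z h w σ β) (hw' : IsInfl z h w' σ β) :
    w = w' := by
  apply perm_ext_of_lt
  intro x y
  obtain ⟨b, i, rfl⟩ := exists_blockEmb z h x
  obtain ⟨b', j, rfl⟩ := exists_blockEmb z h y
  by_cases hb : b = b'
  · subst hb
    rw [hw.same, hw'.same]
    exact id
  · rw [hw.ne _ _ _ _ hb, hw'.ne _ _ _ _ hb]
    exact id

/-- The explicit permutation `inflate` satisfies the comparisons, and the comparisons determine the
permutation. From here on inflations are handled through `IsInfl` only. -/
theorem isInflation_iff : IsInflation w σ z β ↔ (∀ b, 0 < z b) ∧ ∃ h, IsInfl z h w σ β := by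
  refine and_congr_right fun _ => exists_congr fun h => ⟨?_, fun hw => hw.ext (isInfl_inflate σ β)⟩
  rintro rfl
  exact isInfl_inflate σ β

theorem IsInfl.mem_same (hw : IsInfl z h w σ β) (b : Fin m) (i j : Fin (z b)) :
    (blockEmb z h b i, blockEmb z h b j) ∈ invA w ↔ (i, j) ∈ invA (β b) := by
  rw [mem_invA, mem_invA, blockEmb_lt_iff, hw.same]

theorem IsInfl.mem_ne (hw : IsInfl z h w σ β) {b b' : Fin m} (hb : b ≠ b') (i : Fin (z b))
    (j : Fin (z b')) :
    (blockEmb z h b i, blockEmb z h b' j) ∈ invA w ↔ (b, b') ∈ invA σ := by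
  rw [mem_invA, mem_invA, blockEmb_lt_iff_of_ne hb, hw.ne _ _ _ _ hb.symm]

theorem IsInfl.perm_eq_of_eq {σ' : Perm (Fin m)} {β' : ∀ b, Perm (Fin (z b))}
    (hz : ∀ b, 0 < z b) (hw : IsInfl z h w σ β) (hw' : IsInfl z h w σ' β') : σ = σ' := by
  apply perm_ext_of_lt
  intro b b' hlt
  have hb : b ≠ b' := by rintro rfl; exact lt_irrefl _ hlt
  rwa [← hw'.ne b b' ⟨0, hz b⟩ ⟨0, hz b'⟩ hb, hw.ne _ _ _ _ hb]

theorem IsInfl.family_eq_of_eq {σ' : Perm (Fin m)} {β' : ∀ b, Perm (Fin (z b))}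
    (hw : IsInfl z h w σ β) (hw' : IsInfl z h w σ' β') (b : Fin m) : β b = β' b := by
  apply perm_ext_of_lt
  intro i j hlt
  rwa [← hw'.same, hw.same]

theorem isInfl_one : IsInfl z h 1 1 (fun _ => 1) :=
  ⟨fun _ i j => blockEmb_lt_iff (h := h) i j,
    fun _ _ i j hb => blockEmb_lt_iff_of_ne (h := h) hb i j⟩

/-- If the blocks are sent to intervals, the permutation is an inflation. -/
theorem exists_isInfl (hz : ∀ b, 0 < z b) (w : Perm (Fin N))
    (hc : ∀ b b' i i' j j', b ≠ b' → w (blockEmb z h b i) < w (blockEmb z h b' j) →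
      w (blockEmb z h b i') < w (blockEmb z h b' j')) :
    ∃ σ β, IsInfl z h w σ β := by
  obtain ⟨σ, hσ⟩ := exists_perm_lt (fun b => w (blockEmb z h b ⟨0, hz b⟩)) (by
    intro b b' e
    by_contra hb
    exact blockEmb_ne hb _ _ (w.injective e))
  choose β hβ using fun b => exists_perm_lt (fun i => w (blockEmb z h b i))
    (w.injective.comp (blockEmb_injective b))
  refine ⟨σ, β, fun b i j => (hβ b i j).symm, fun b b' i j hb => ?_⟩
  rw [hσ]
  exact ⟨hc _ _ _ _ _ _ hb, hc _ _ _ _ _ _ hb⟩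

/-- A pair of letters lies either inside one block, where only `β` matters, or across two blocks,
where only `σ` matters. So decompositions of the block permutation and of the pieces can be glued.
-/
theorem IsInfl.isDisjointUnion {r : ℕ} {W : Fin r → Perm (Fin N)} {S : Fin r → Perm (Fin m)}
    {B : Fin r → ∀ b, Perm (Fin (z b))} (hw : IsInfl z h w σ β)
    (hW : ∀ k, IsInfl z h (W k) (S k) (B k))
    (hS : IsDisjointUnion (invA σ) fun k => invA (S k))
    (hB : ∀ b, IsDisjointUnion (invA (β b)) fun k => invA (B k b)) :
    IsDisjointUnion (invA w) fun k => invA (W k) := by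
  simp only [isDisjointUnion_iff] at *
  constructor
  · rintro ⟨x, y⟩
    obtain ⟨b, i, rfl⟩ := exists_blockEmb z h x
    obtain ⟨b', j, rfl⟩ := exists_blockEmb z h y
    by_cases hb : b = b'
    · subst hb
      simp only [hw.mem_same, (hW _).mem_same]
      exact (hB b).1 _
    · simp only [hw.mem_ne hb, (hW _).mem_ne hb]
      exact hS.1 _
  · rintro ⟨x, y⟩ a a'
    obtain ⟨b, i, rfl⟩ := exists_blockEmb z h x
    obtain ⟨b', j, rfl⟩ := exists_blockEmb z h y
    by_cases hb : b = b'
    · subst hb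
      simp only [(hW _).mem_same]
      exact (hB b).2 _ _ _
    · simp only [(hW _).mem_ne hb]
      exact hS.2 _ _ _

theorem IsInfl.isDisjointUnion_family {r : ℕ} {W : Fin r → Perm (Fin N)}
    {S : Fin r → Perm (Fin m)} {B : Fin r → ∀ b, Perm (Fin (z b))} (hw : IsInfl z h w σ β)
    (hW : ∀ k, IsInfl z h (W k) (S k) (B k))
    (hD : IsDisjointUnion (invA w) fun k => invA (W k)) (b : Fin m) :
    IsDisjointUnion (invA (β b)) fun k => invA (B k b) := by
  simp only [isDisjointUnion_iff] at *
  refine ⟨fun ⟨i, j⟩ => ?_, fun ⟨i, j⟩ a a' => ?_⟩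
  · rw [← hw.mem_same, hD.1]
    simp only [(hW _).mem_same]
  · rw [← (hW _).mem_same, ← (hW _).mem_same]
    exact hD.2 _ _ _

theorem IsInfl.isDisjointUnion_perm {r : ℕ} {W : Fin r → Perm (Fin N)}
    {S : Fin r → Perm (Fin m)} {B : Fin r → ∀ b, Perm (Fin (z b))} (hz : ∀ b, 0 < z b)
    (hw : IsInfl z h w σ β) (hW : ∀ k, IsInfl z h (W k) (S k) (B k))
    (hD : IsDisjointUnion (invA w) fun k => invA (W k)) :
    IsDisjointUnion (invA σ) fun k => invA (S k) := by
  simp only [isDisjointUnion_iff] at *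
  have key : ∀ (w : Perm (Fin N)) (σ : Perm (Fin m)) (β : ∀ b, Perm (Fin (z b))),
      IsInfl z h w σ β → ∀ b b', (b, b') ∈ invA σ ↔ b < b' ∧
        (blockEmb z h b ⟨0, hz b⟩, blockEmb z h b' ⟨0, hz b'⟩) ∈ invA w := by
    intro w σ β hw b b'
    constructor
    · intro hm
      exact ⟨hm.1, (hw.mem_ne hm.1.ne _ _).2 hm⟩
    · rintro ⟨hlt, hm⟩
      exact (hw.mem_ne hlt.ne _ _).1 hm
  refine ⟨fun ⟨i, j⟩ => ?_, fun ⟨i, j⟩ a a' => ?_⟩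
  · simp only [key _ _ _ hw, key _ _ _ (hW _), hD.1]
    tauto
  · simp only [key _ _ _ (hW _)]
    exact fun h1 h2 => hD.2 _ _ _ h1.2 h2.2

/-! ### Symmetric divisions -/

/-- Reversing within the blocks, reversing the order of the blocks and finally reversing all letters
is an increasing map, hence the identity. -/
theorem blockEmb_rev (hz : ∀ b, z b = z b.rev) (b : Fin m) (i : Fin (z b)) :
    blockEmb z h b.rev (finCongr (hz b) i.rev) = (blockEmb z h b i).rev := by
  have e : ∀ x : Fin N, ∃ y : Fin N, ∀ b i, x = blockEmb z h b i →
      y = (blockEmb z h b.rev (finCongr (hz b) i.rev)).rev := by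
    intro x
    obtain ⟨b, i, rfl⟩ := exists_blockEmb z h x
    refine ⟨(blockEmb z h b.rev (finCongr (hz b) i.rev)).rev, fun b' i' hx => ?_⟩
    by_cases hb : b = b'
    · subst hb
      rw [← blockEmb_injective b hx]
    · exact absurd hx (blockEmb_ne hb _ _)
  choose g hg using e
  have hg1 : StrictMono g := by
    intro x y hxy
    obtain ⟨b, i, rfl⟩ := exists_blockEmb z h x
    obtain ⟨b', j, rfl⟩ := exists_blockEmb z h y
    rw [hg _ b i rfl, hg _ b' j rfl, Fin.rev_lt_rev]
    by_cases hb : b = b'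
    · subst hb
      rw [blockEmb_lt_iff] at hxy ⊢
      simpa using hxy
    · rw [blockEmb_lt_iff_of_ne hb] at hxy
      exact blockEmb_lt_of_lt (Fin.rev_lt_rev.2 hxy) _ _
  have := hg _ b i rfl
  rw [strictMono_fin_eq_id hg1, id] at this
  rw [this, Fin.rev_rev]

theorem IsInfl.isSymm (hβ : IsSymmetricFamily z β) (hσ : IsSymm σ) (hw : IsInfl z h w σ β) :
    IsSymm w := by
  obtain ⟨hz, hβ⟩ := hβ
  apply isSymm_of_lt
  intro x y
  obtain ⟨b, i, rfl⟩ := exists_blockEmb z h x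
  obtain ⟨b', j, rfl⟩ := exists_blockEmb z h y
  rw [← blockEmb_rev hz, ← blockEmb_rev hz]
  by_cases hb : b = b'
  · subst hb
    rw [hw.same, hw.same, hβ]
    simp [longest_apply]
  · rw [hw.ne _ _ _ _ hb, hw.ne _ _ _ _ (by simpa using Ne.symm hb), hσ.lt_iff]
    exact id

theorem IsInfl.isSymm_perm (hz : ∀ b, z b = z b.rev) (hz0 : ∀ b, 0 < z b) (hs : IsSymm w)
    (hw : IsInfl z h w σ β) : IsSymm σ := by
  apply isSymm_of_lt
  intro b b' hlt
  have hb : b ≠ b' := by rintro rfl; exact lt_irrefl _ hlt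
  rw [← hw.ne b b' ⟨0, hz0 b⟩ ⟨0, hz0 b'⟩ hb, ← hs.lt_iff, ← blockEmb_rev hz, ← blockEmb_rev hz,
    hw.ne _ _ _ _ (by simpa using Ne.symm hb)] at hlt
  exact hlt

theorem IsInfl.isSymmetricFamily (hz : ∀ b, z b = z b.rev) (hs : IsSymm w)
    (hw : IsInfl z h w σ β) : IsSymmetricFamily z β := by
  refine ⟨hz, fun b => ?_⟩
  symm
  apply perm_ext_of_lt
  intro i j
  obtain ⟨i, rfl⟩ := (finCongr (hz b)).surjective i
  obtain ⟨j, rfl⟩ := (finCongr (hz b)).surjective j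
  have h1 := hw.same b j.rev i.rev
  rw [← hs.lt_iff, ← blockEmb_rev hz, ← blockEmb_rev hz, hw.same, Fin.rev_rev, Fin.rev_rev] at h1
  rw [h1]
  simp [longest_apply]

end blocks

/-! ### Signed permutations as symmetric permutations -/

theorem eps_rev {n : ℕ} (k : Fin (2 * n + 1)) : eps n k.rev = -eps n k := by
  ext i
  simp only [eps, Fin.val_rev, Pi.neg_apply]
  have := k.2
  have := i.2
  split_ifs <;> omega

theorem eps_castLE {n : ℕ} (i : Fin n) :
    eps n (Fin.castLE (by omega) i) = Pi.single i 1 := by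
  ext j
  simp only [eps, Fin.val_castLE, Pi.single_apply, Fin.ext_iff]
  have := i.2
  have := j.2
  split_ifs <;> omega

theorem eps_eq_zero_iff {n : ℕ} (k : Fin (2 * n + 1)) : eps n k = 0 ↔ k.rev = k := by
  rw [← (eps_injective n).eq_iff, eps_rev, neg_eq_self]

theorem eps_eq_neg_iff {n : ℕ} (k l : Fin (2 * n + 1)) : eps n l = -eps n k ↔ l = k.rev := by
  rw [← eps_rev, (eps_injective n).eq_iff]

theorem eps_cases {n : ℕ} (k : Fin (2 * n + 1)) :
    (∃ i : Fin n, (k : ℕ) = i ∧ eps n k = Pi.single i 1) ∨ ((k : ℕ) = n ∧ eps n k = 0) ∨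
      ∃ i : Fin n, (k : ℕ) + i = 2 * n ∧ eps n k = -Pi.single i 1 := by
  have hk := k.2
  rcases lt_trichotomy (k : ℕ) n with h | h | h
  · exact Or.inl ⟨⟨k, h⟩, rfl, eps_castLE (⟨k, h⟩ : Fin n)⟩
  · refine Or.inr (Or.inl ⟨h, (eps_eq_zero_iff k).2 (Fin.ext ?_)⟩)
    rw [Fin.val_rev]
    omega
  · refine Or.inr (Or.inr ⟨⟨2 * n - k, by omega⟩, by simp only; omega, ?_⟩)
    rw [← eps_castLE, ← eps_rev]
    congr 1
    ext
    simp only [Fin.val_rev, Fin.val_castLE]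
    omega

theorem eps_tilde {n : ℕ} (σ : WeylB n) (k : Fin (2 * n + 1)) :
    eps n (tilde σ k) = (σ : Perm (signedVectors n)) ⟨eps n k, Set.mem_range_self _⟩ := by
  have : (tilde σ k) = (Equiv.ofInjective (eps n) (eps_injective n)).symm
    ((σ : Perm (signedVectors n)) (Equiv.ofInjective (eps n) (eps_injective n) k)) := rfl
  rw [this]
  exact Equiv.apply_ofInjective_symm (eps_injective n) _

theorem isSymm_tilde {n : ℕ} (σ : WeylB n) : IsSymm (tilde σ) := by
  intro k
  apply eps_injective
  rw [eps_rev, eps_tilde, eps_tilde]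
  exact (σ.2.2 ⟨eps n k, Set.mem_range_self _⟩ ⟨eps n k.rev, Set.mem_range_self _⟩).1 (eps_rev k)

/-- Reversing the index negates `eps`, and the only index fixed by the reversal is that of the
vector `0`. So commuting with the reversal yields both defining conditions of `WeylB`. -/
theorem exists_tilde_eq {n : ℕ} {τ : Perm (Fin (2 * n + 1))} (hτ : IsSymm τ) :
    ∃ σ : WeylB n, tilde σ = τ := by
  let e := Equiv.ofInjective (eps n) (eps_injective n)
  have he : ∀ k, (e.permCongr τ (e k) : Fin n → ℤ) = eps n (τ k) := fun k => by
    rw [Equiv.permCongr_apply, Equiv.symm_apply_apply]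
    rfl
  refine ⟨⟨e.permCongr τ, fun x => ?_, fun x y => ?_⟩, ?_⟩
  · obtain ⟨k, rfl⟩ := e.surjective x
    rw [he]
    change eps n k = 0 ↔ _
    rw [eps_eq_zero_iff, eps_eq_zero_iff, ← hτ, τ.injective.eq_iff]
  · obtain ⟨k, rfl⟩ := e.surjective x
    obtain ⟨l, rfl⟩ := e.surjective y
    rw [he, he]
    change eps n l = -eps n k ↔ _
    rw [eps_eq_neg_iff, eps_eq_neg_iff, ← hτ, τ.injective.eq_iff]
  · ext k : 1
    apply eps_injective
    rw [eps_tilde]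
    exact he k

theorem tilde_injective {n : ℕ} : Injective (tilde (n := n)) := by
  intro σ σ' h
  refine Subtype.ext (Equiv.ext ?_)
  rintro ⟨_, k, rfl⟩
  refine Subtype.ext ?_
  rw [← eps_tilde, ← eps_tilde, h]

/-! ### The linear action, and roots of type B as pairs of letters -/

theorem actB_neg {n : ℕ} (σ : WeylB n) (v : Fin n → ℤ) : actB σ (-v) = -actB σ v := by
  simp [actB]

theorem actB_sub {n : ℕ} (σ : WeylB n) (v v' : Fin n → ℤ) :
    actB σ (v - v') = actB σ v - actB σ v' := by
  simp [actB, sub_smul]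

theorem actB_eps {n : ℕ} (σ : WeylB n) (k : Fin (2 * n + 1)) :
    actB σ (eps n k) = eps n (tilde σ k) := by
  have key : ∀ i : Fin n, actB σ (Pi.single i 1) = eps n (tilde σ (Fin.castLE (by omega) i)) := by
    intro i
    rw [eps_tilde, actB, Finset.sum_eq_single i]
    · simp
    · intro j _ hj
      simp [hj]
    · simp
  rcases eps_cases k with ⟨i, hk, hi⟩ | ⟨-, h0⟩ | ⟨i, hk, hi⟩
  · rw [hi, key]
    congr 2
    exact Fin.ext hk.symm
  · have h1 := (eps_eq_zero_iff k).1 h0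
    rw [h0, (eps_eq_zero_iff _).2 (by rw [← isSymm_tilde, h1])]
    simp [actB]
  · rw [hi, actB_neg, key, ← eps_rev, ← isSymm_tilde]
    congr 2
    ext
    simp only [Fin.val_rev, Fin.val_castLE]
    omega

/-- The root of type `B_n` attached to a pair of letters among `1, …, 2n+1`. -/
noncomputable def rootOfPair {n : ℕ} (x y : Fin (2 * n + 1)) : Fin n → ℤ :=
  if y = x.rev then eps n x else eps n x - eps n y

theorem actB_rootOfPair {n : ℕ} (σ : WeylB n) (x y : Fin (2 * n + 1)) :
    actB σ (rootOfPair x y) = rootOfPair (tilde σ x) (tilde σ y) := by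
  have : tilde σ y = (tilde σ x).rev ↔ y = x.rev := by
    rw [← isSymm_tilde, (tilde σ).injective.eq_iff]
  unfold rootOfPair
  simp only [this]
  split_ifs
  · exact actB_eps σ x
  · rw [actB_sub, actB_eps, actB_eps]

theorem neg_rootOfPair {n : ℕ} (x y : Fin (2 * n + 1)) :
    -rootOfPair x y = rootOfPair y x := by
  have : x = y.rev ↔ y = x.rev := by
    constructor <;> (rintro rfl; rw [Fin.rev_rev])
  unfold rootOfPair
  simp only [this]
  split_ifs with h
  · rw [h, eps_rev]
  · rw [neg_sub]

/-- The weighted height `∑ (n - i) v_i`, positive on positive roots. -/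
def weightedHeight {n : ℕ} (v : Fin n → ℤ) : ℤ := ∑ i : Fin n, v i * ((n : ℤ) - i)

theorem weightedHeight_sub {n : ℕ} (v v' : Fin n → ℤ) :
    weightedHeight (v - v') = weightedHeight v - weightedHeight v' := by
  simp [weightedHeight, sub_mul]

theorem weightedHeight_add {n : ℕ} (v v' : Fin n → ℤ) :
    weightedHeight (v + v') = weightedHeight v + weightedHeight v' := by
  simp [weightedHeight, add_mul, Finset.sum_add_distrib]

theorem weightedHeight_single {n : ℕ} (i : Fin n) :
    weightedHeight (Pi.single i 1) = (n : ℤ) - i := by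
  rw [weightedHeight, Finset.sum_eq_single i]
  · simp
  · intro j _ hj
    simp [hj]
  · simp

/-- The height decreases along the list `ε_1, …, 0, …, -ε_1`, so the order of a pair of letters can
be read off from the positivity of its root. -/
theorem weightedHeight_eps {n : ℕ} (k : Fin (2 * n + 1)) :
    weightedHeight (eps n k) = (n : ℤ) - k := by
  rcases eps_cases k with ⟨i, hk, hi⟩ | ⟨hk, h0⟩ | ⟨i, hk, hi⟩
  · rw [hi, weightedHeight_single, hk]
  · simp [h0, hk, weightedHeight]
  · rw [hi, ← zero_sub, weightedHeight_sub, weightedHeight_single]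
    simp only [weightedHeight, Pi.zero_apply, zero_mul, Finset.sum_const_zero]
    omega

theorem weightedHeight_pos {n : ℕ} {v : Fin n → ℤ} (hv : v ∈ posRootsB n) :
    0 < weightedHeight v := by
  rcases hv with ⟨i, j, hij, rfl⟩ | ⟨i, j, hij, rfl⟩ | ⟨i, rfl⟩
  · rw [weightedHeight_sub, weightedHeight_single, weightedHeight_single]
    omega
  · rw [weightedHeight_add, weightedHeight_single, weightedHeight_single]
    omega
  · rw [weightedHeight_single]
    omega

theorem rootOfPair_mem_of_lt {n : ℕ} {x y : Fin (2 * n + 1)} (h : x < y) :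
    rootOfPair x y ∈ posRootsB n := by
  rw [Fin.lt_def] at h
  unfold rootOfPair
  split_ifs with hy
  · rw [hy, Fin.val_rev] at h
    rcases eps_cases x with ⟨i, hk, hi⟩ | ⟨hk, h0⟩ | ⟨i, hk, hi⟩
    · exact Or.inr (Or.inr ⟨i, hi⟩)
    · omega
    · have := i.2
      omega
  · rw [Fin.ext_iff, Fin.val_rev] at hy
    rcases eps_cases x with ⟨i, hk, hi⟩ | ⟨hk, hi⟩ | ⟨i, hk, hi⟩ <;>
      rcases eps_cases y with ⟨j, hl, hj⟩ | ⟨hl, hj⟩ | ⟨j, hl, hj⟩ <;> rw [hi, hj] <;>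
      have := x.2 <;> have := y.2
    · exact Or.inl ⟨i, j, by omega, rfl⟩
    · exact Or.inr (Or.inr ⟨i, by simp⟩)
    · rw [sub_neg_eq_add]
      have hne : (i : ℕ) ≠ j := by omega
      rcases Nat.lt_or_gt_of_ne hne with hlt | hlt
      · exact Or.inr (Or.inl ⟨i, j, hlt, rfl⟩)
      · exact Or.inr (Or.inl ⟨j, i, hlt, add_comm _ _⟩)
    · omega
    · omega
    · exact Or.inr (Or.inr ⟨j, by simp⟩)
    · omega
    · omega
    · exact Or.inl ⟨j, i, by omega, by abel⟩

theorem rootOfPair_mem_iff {n : ℕ} {x y : Fin (2 * n + 1)} :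
    rootOfPair x y ∈ posRootsB n ↔ x < y := by
  refine ⟨fun h => ?_, rootOfPair_mem_of_lt⟩
  have hp := weightedHeight_pos h
  unfold rootOfPair at hp
  rw [Fin.lt_def]
  split_ifs at hp with hy
  · rw [weightedHeight_eps] at hp
    rw [hy, Fin.val_rev]
    omega
  · rw [weightedHeight_sub, weightedHeight_eps, weightedHeight_eps] at hp
    omega

theorem rootOfPair_mem_invB {n : ℕ} (σ : WeylB n) {x y : Fin (2 * n + 1)} :
    rootOfPair x y ∈ invB σ ↔ (x, y) ∈ invA (tilde σ) := by
  rw [mem_invA, invB, Set.mem_sep_iff, actB_rootOfPair, neg_rootOfPair, rootOfPair_mem_iff,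
    rootOfPair_mem_iff]

theorem exists_rootOfPair {n : ℕ} {v : Fin n → ℤ} (hv : v ∈ posRootsB n) :
    ∃ x y : Fin (2 * n + 1), x < y ∧ v = rootOfPair x y := by
  have c : ∀ i : Fin n, ((Fin.castLE (by omega) i : Fin (2 * n + 1)) : ℕ) = i := fun _ => rfl
  rcases hv with ⟨i, j, hij, rfl⟩ | ⟨i, j, hij, rfl⟩ | ⟨i, rfl⟩
  · refine ⟨Fin.castLE (by omega) i, Fin.castLE (by omega) j, hij, ?_⟩
    rw [rootOfPair, if_neg, eps_castLE, eps_castLE]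
    rw [Fin.ext_iff, Fin.val_rev, c, c]
    omega
  · refine ⟨Fin.castLE (by omega) i, (Fin.castLE (by omega) j).rev, ?_, ?_⟩
    · rw [Fin.lt_def, Fin.val_rev, c, c]
      omega
    · rw [rootOfPair, if_neg, eps_rev, eps_castLE, eps_castLE, sub_neg_eq_add]
      rw [Fin.ext_iff, Fin.val_rev, Fin.val_rev, c, c]
      omega
  · refine ⟨Fin.castLE (by omega) i, (Fin.castLE (by omega) i).rev, ?_, ?_⟩
    · rw [Fin.lt_def, Fin.val_rev, c]
      omega
    · rw [rootOfPair, if_pos rfl, eps_castLE]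

/-- A positive root may come from two pairs, `(x, y)` and `(y.rev, x.rev)`, so the correspondence is
not bijective. It suffices that every positive root comes from an increasing pair and that
membership can be tested on any such pair. -/
theorem isDisjointUnion_iff_of_pairs {n r : ℕ} {S : Set (Fin n → ℤ)} {F : Fin r → Set (Fin n → ℤ)}
    {S' : Set (Fin (2 * n + 1) × Fin (2 * n + 1))}
    {F' : Fin r → Set (Fin (2 * n + 1) × Fin (2 * n + 1))}
    (hS : S ⊆ posRootsB n) (hF : ∀ a, F a ⊆ posRootsB n)
    (hS' : S' ⊆ posRootsA (2 * n + 1)) (hF' : ∀ a, F' a ⊆ posRootsA (2 * n + 1))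
    (h : ∀ x y, x < y → (rootOfPair x y ∈ S ↔ (x, y) ∈ S'))
    (h' : ∀ a x y, x < y → (rootOfPair x y ∈ F a ↔ (x, y) ∈ F' a)) :
    IsDisjointUnion S F ↔ IsDisjointUnion S' F' := by
  rw [isDisjointUnion_iff, isDisjointUnion_iff]
  constructor
  · rintro ⟨h1, h2⟩
    refine ⟨?_, ?_⟩
    · rintro ⟨x, y⟩
      constructor
      · intro hm
        obtain ⟨a, ha⟩ := (h1 _).1 ((h x y (hS' hm)).2 hm)
        exact ⟨a, (h' a x y (hS' hm)).1 ha⟩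
      · rintro ⟨a, ha⟩
        exact (h x y (hF' a ha)).1 ((h1 _).2 ⟨a, (h' a x y (hF' a ha)).2 ha⟩)
    · rintro ⟨x, y⟩ a b ha hb
      exact h2 _ a b ((h' a x y (hF' a ha)).2 ha) ((h' b x y (hF' b hb)).2 hb)
  · rintro ⟨h1, h2⟩
    refine ⟨?_, ?_⟩
    · intro v
      constructor
      · intro hm
        obtain ⟨x, y, hxy, rfl⟩ := exists_rootOfPair (hS hm)
        obtain ⟨a, ha⟩ := (h1 _).1 ((h x y hxy).1 hm)
        exact ⟨a, (h' a x y hxy).2 ha⟩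
      · rintro ⟨a, ha⟩
        obtain ⟨x, y, hxy, rfl⟩ := exists_rootOfPair (hF a ha)
        exact (h x y hxy).2 ((h1 _).2 ⟨a, (h' a x y hxy).1 ha⟩)
    · intro v a b ha hb
      obtain ⟨x, y, hxy, rfl⟩ := exists_rootOfPair (hF a ha)
      exact h2 _ a b ((h' a x y hxy).1 ha) ((h' b x y hxy).1 hb)

theorem invB_subset {n : ℕ} (σ : WeylB n) : invB σ ⊆ posRootsB n := fun _ h => h.1

theorem invA_subset {N : ℕ} (σ : Perm (Fin N)) : invA σ ⊆ posRootsA N := fun _ h => h.1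

theorem isDisjointUnion_posRootsB_iff {n r : ℕ} (w : Fin r → WeylB n) :
    IsDisjointUnion (posRootsB n) (fun a => invB (w a)) ↔
      IsDisjointUnion (posRootsA (2 * n + 1)) fun a => invA (tilde (w a)) :=
  isDisjointUnion_iff_of_pairs subset_rfl (fun _ => invB_subset _) subset_rfl
    (fun _ => invA_subset _) (fun _ _ hxy => iff_of_true (rootOfPair_mem_of_lt hxy) hxy)
    fun _ _ _ _ => rootOfPair_mem_invB _

theorem isDisjointUnion_invB_iff {n r : ℕ} (σ : WeylB n) (w : Fin r → WeylB n) :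
    IsDisjointUnion (invB σ) (fun a => invB (w a)) ↔
      IsDisjointUnion (invA (tilde σ)) fun a => invA (tilde (w a)) :=
  isDisjointUnion_iff_of_pairs (invB_subset _) (fun _ => invB_subset _) (invA_subset _)
    (fun _ => invA_subset _) (fun _ _ _ => rootOfPair_mem_invB _)
    fun _ _ _ _ => rootOfPair_mem_invB _

theorem invB_injective {n : ℕ} : Injective (invB (n := n)) := by
  intro σ σ' h
  apply tilde_injective
  apply invA_injective
  ext ⟨x, y⟩
  constructor
  · intro hm
    rwa [← rootOfPair_mem_invB, ← h, rootOfPair_mem_invB]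
  · intro hm
    rwa [← rootOfPair_mem_invB, h, rootOfPair_mem_invB]

theorem invB_one (n : ℕ) : invB (1 : WeylB n) = ∅ := by
  ext v
  simp only [Set.mem_empty_iff_false, iff_false]
  intro hv
  obtain ⟨x, y, hxy, rfl⟩ := exists_rootOfPair (invB_subset _ hv)
  rw [rootOfPair_mem_invB, map_one, invA_one] at hv
  exact hv

/-! ### Irreducibility -/

theorem irreducibleA_iff {N : ℕ} {σ : Perm (Fin N)} : IrreducibleA σ ↔
    ∀ (k : ℕ) (γ : Fin (k + 1) → Perm (Fin N)),
      IsDisjointUnion (invA σ) (fun a => invA (γ a)) → ∃ a, γ a = σ := by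
  simp only [IrreducibleA, invA_injective.eq_iff]

/-- Irreducibility of a permutation among the symmetric ones. -/
def SymmIrreducible {N : ℕ} (σ : Perm (Fin N)) : Prop :=
  ∀ (k : ℕ) (γ : Fin (k + 1) → Perm (Fin N)), (∀ a, IsSymm (γ a)) →
    IsDisjointUnion (invA σ) (fun a => invA (γ a)) → ∃ a, γ a = σ

/-- Symmetric permutations lift to `WeylB`, and the decompositions correspond. Irreducibility in
type B is thus irreducibility among symmetric permutations, which can be weaker than `IrreducibleA`.
-/
theorem irreducibleB_iff {n : ℕ} {σ : WeylB n} : IrreducibleB σ ↔ SymmIrreducible (tilde σ) := by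
  constructor
  · intro h k γ hγ hD
    choose g hg using fun a => exists_tilde_eq (hγ a)
    obtain ⟨a, ha⟩ := h k g ((isDisjointUnion_invB_iff _ _).2 (by simpa only [hg] using hD))
    exact ⟨a, by rw [← hg, invB_injective ha]⟩
  · intro h k γ hD
    obtain ⟨a, ha⟩ := h k _ (fun a => isSymm_tilde (γ a)) ((isDisjointUnion_invB_iff _ _).1 hD)
    exact ⟨a, by rw [tilde_injective ha]⟩

theorem irreducibleSymmetric_iff {N : ℕ} {β : Perm (Fin N)} :
    IrreducibleSymmetric β ↔ (∃ k, N = 2 * k + 1) ∧ IsSymm β ∧ SymmIrreducible β := by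
  constructor
  · rintro ⟨k, rfl, τ, hτ, hi⟩
    have hβ : β = tilde τ := hτ
    rw [hβ]
    exact ⟨⟨k, rfl⟩, isSymm_tilde τ, irreducibleB_iff.1 hi⟩
  · rintro ⟨⟨k, rfl⟩, hs, hi⟩
    obtain ⟨τ, hτ⟩ := exists_tilde_eq hs
    exact ⟨k, rfl, τ, hτ.symm, irreducibleB_iff.2 (by rwa [hτ])⟩

/-- A symmetric irreducible permutation is not a disjoint union of two symmetric inversion sets
in a nontrivial way. -/
theorem SymmIrreducible.eq_one_or_eq_one {N : ℕ} {w u v : Perm (Fin N)} (hw : SymmIrreducible w)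
    (hu : IsSymm u) (hv : IsSymm v) (hD : IsDisjointUnion (invA w) fun a => invA (![u, v] a)) :
    u = 1 ∨ v = 1 := by
  obtain ⟨a, ha⟩ := hw 1 ![u, v] (fun a => by fin_cases a <;> assumption) hD
  rw [isDisjointUnion_iff] at hD
  fin_cases a
  · right
    apply invA_injective
    rw [invA_one, Set.eq_empty_iff_forall_notMem]
    intro x hx
    have h1 := (hD.1 x).2 ⟨1, hx⟩
    rw [← ha] at h1
    exact absurd (hD.2 x 0 1 h1 hx) (by decide)
  · left
    apply invA_injective
    rw [invA_one, Set.eq_empty_iff_forall_notMem]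
    intro x hx
    have h1 := (hD.1 x).2 ⟨0, hx⟩
    rw [← ha] at h1
    exact absurd (hD.2 x 0 1 hx h1) (by decide)

theorem isDisjointUnion_empty {X : Type*} {r : ℕ} :
    IsDisjointUnion (∅ : Set X) fun _ : Fin r => ∅ :=
  ⟨fun _ _ _ => disjoint_bot_left, by simp⟩

theorem isDisjointUnion_one {N r : ℕ} :
    IsDisjointUnion (invA (1 : Perm (Fin N))) fun _ : Fin r => invA 1 := by
  rw [invA_one]
  exact isDisjointUnion_empty

theorem isDisjointUnion_self_one {N : ℕ} (β : Perm (Fin N)) :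
    IsDisjointUnion (invA β) fun a => invA (![β, 1] a) := by
  rw [isDisjointUnion_iff]
  refine ⟨fun x => ?_, fun x a b => ?_⟩
  · simp [Fin.exists_fin_two, invA_one]
  · fin_cases a <;> fin_cases b <;> simp [invA_one]

theorem isDisjointUnion_one_self {N : ℕ} (β : Perm (Fin N)) :
    IsDisjointUnion (invA β) fun a => invA (![1, β] a) := by
  rw [isDisjointUnion_iff]
  refine ⟨fun x => ?_, fun x a b => ?_⟩
  · simp [Fin.exists_fin_two, invA_one]
  · fin_cases a <;> fin_cases b <;> simp [invA_one]

theorem irreducibleA_one {N : ℕ} : IrreducibleA (1 : Perm (Fin N)) := by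
  rw [irreducibleA_iff]
  intro k γ hD
  refine ⟨0, invA_injective ?_⟩
  rw [isDisjointUnion_iff] at hD
  rw [invA_one, Set.eq_empty_iff_forall_notMem]
  intro x hx
  have := (hD.1 x).2 ⟨0, hx⟩
  rwa [invA_one] at this

open Relation

/-! ### Gallai colourings -/

/-- The edges of colour `d` inside a vertex set `V`. -/
def ColorAdj {α C : Type*} (c : α → α → C) (d : C) (V : Set α) (x y : α) : Prop :=
  x ∈ V ∧ y ∈ V ∧ x ≠ y ∧ c x y = d

section Gallai

variable {α C : Type*} {c : α → α → C} {d : C} {V : Set α}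

theorem reach_symm (hs : ∀ x y, c x y = c y x) {x y : α} (h : ReflTransGen (ColorAdj c d V) x y) :
    ReflTransGen (ColorAdj c d V) y x := by
  induction h with
  | refl => exact ReflTransGen.refl
  | tail _ he ih =>
    obtain ⟨hb, hb', hne, hc⟩ := he
    exact ReflTransGen.head ⟨hb', hb, hne.symm, by rw [hs, hc]⟩ ih

theorem reach_equivalence (hs : ∀ x y, c x y = c y x) :
    Equivalence (ReflTransGen (ColorAdj c d V)) :=
  ⟨fun _ => ReflTransGen.refl, reach_symm hs, ReflTransGen.trans⟩

/-- Move along one edge `bb'` of colour `d`. Neither `by` nor `b'y` has colour `d`, since `y` is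
outside the component, so the triangle `b b' y` can only avoid being rainbow if these two sides have
equal colours. -/
theorem reach_color_eq
    (ht : ∀ x y z, x ≠ y → y ≠ z → x ≠ z → c x y = c y z ∨ c x z = c x y ∨ c x z = c y z)
    {x x' y : α} (hy : y ∈ V) (h : ReflTransGen (ColorAdj c d V) x x')
    (hn : ¬ ReflTransGen (ColorAdj c d V) x y) : c x y = c x' y := by
  have key : ∀ b ∈ V, ReflTransGen (ColorAdj c d V) x b → b ≠ y ∧ c b y ≠ d := by
    intro b hb hr
    have hby : b ≠ y := by rintro rfl; exact hn hr
    exact ⟨hby, fun hc => hn (hr.tail ⟨hb, hy, hby, hc⟩)⟩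
  induction h with
  | refl => rfl
  | tail hr he ih =>
    rename_i b b'
    obtain ⟨hb, hb', hne, hc⟩ := he
    rw [ih]
    obtain ⟨h1, h2⟩ := key b hb hr
    obtain ⟨h3, h4⟩ := key b' hb' (hr.tail ⟨hb, hb', hne, hc⟩)
    rcases ht b b' y hne h3 h1 with h | h | h
    · exact absurd (h.symm.trans hc) h4
    · exact absurd (h.trans hc) h2
    · exact h

theorem reach_exists_adj {x y : α} (h : ReflTransGen (ColorAdj c d V) x y) (hxy : x ≠ y) :
    ∃ b ∈ V, x ≠ b ∧ c x b = d := by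
  rcases ReflTransGen.cases_head h with h | ⟨b, ⟨-, hb, hne, hc⟩, -⟩
  · exact absurd h hxy
  · exact ⟨b, hb, hne, hc⟩

/-- In a colouring without rainbow triangles on at least two vertices, at most two of the colours
have a connected graph. -/
theorem not_three_connected [DecidableEq α] (hs : ∀ x y, c x y = c y x)
    (ht : ∀ x y z, x ≠ y → y ≠ z → x ≠ z → c x y = c y z ∨ c x z = c x y ∨ c x z = c y z)
    (d : Fin 3 → C) (hd : Injective d) (V : Finset α) (hV : 1 < V.card)
    (hr : ∀ t, ∀ x ∈ V, ∀ y ∈ V, ReflTransGen (ColorAdj c (d t) V) x y) : False := by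
  induction V using Finset.induction with
  | empty => simp at hV
  | insert v W hv ih =>
    have hadj : ∀ t, ∃ x ∈ W, c x v = d t := by
      intro t
      obtain ⟨y, hy, hyv⟩ := Finset.exists_mem_ne hV v
      obtain ⟨b, hb, hvb, hc⟩ :=
        reach_exists_adj (hr t v (Finset.mem_insert_self v W) y hy) hyv.symm
      rw [Finset.mem_coe, Finset.mem_insert] at hb
      exact ⟨b, hb.resolve_left hvb.symm, by rw [hs, hc]⟩
    by_cases hW : 1 < W.card
    -- After deletion of `v`, induction makes the graph of one colour `d t` disconnected on `W`; the
    -- other two colours `t₁`, `t₂` will conflict.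
    · have hn : ¬ ∀ t, ∀ x ∈ W, ∀ y ∈ W, ReflTransGen (ColorAdj c (d t) W) x y := ih hW
      push Not at hn
      obtain ⟨t, y₀, hy₀, y₁, hy₁, hn⟩ := hn
      obtain ⟨t₁, t₂, h1, h2, h12⟩ : ∃ t₁ t₂ : Fin 3, t₁ ≠ t ∧ t₂ ≠ t ∧ t₁ ≠ t₂ := by
        clear hn
        revert t
        decide
      -- With `v` present colour `d t` is connected, so a path from `u` to `v`, stopped just before
      -- its first visit to `v`, shows that each component inside `W` contains a neighbour of `v` in
      -- that colour.
      have fact2 : ∀ u ∈ W, ∃ y ∈ W, ReflTransGen (ColorAdj c (d t) W) u y ∧ c y v = d t := by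
        intro u hu
        have := hr t u (Finset.mem_insert_of_mem hu) v (Finset.mem_insert_self v W)
        have key : ∀ b, ReflTransGen (ColorAdj c (d t) (insert v W : Finset α)) u b →
            (b ∈ W ∧ ReflTransGen (ColorAdj c (d t) W) u b) ∨
              ∃ y ∈ W, ReflTransGen (ColorAdj c (d t) W) u y ∧ c y v = d t := by
          intro b hb
          induction hb with
          | refl => exact Or.inl ⟨hu, ReflTransGen.refl⟩
          | tail _ he ih =>
            rename_i b b' _
            rcases ih with ⟨hb, hub⟩ | h
            · obtain ⟨-, hb', hne, hc⟩ := he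
              rw [Finset.mem_coe, Finset.mem_insert] at hb'
              rcases hb' with rfl | hb'
              · exact Or.inr ⟨b, hb, hub, hc⟩
              · exact Or.inl ⟨hb', hub.tail ⟨hb, hb', hne, hc⟩⟩
            · exact Or.inr h
        rcases key v this with ⟨h, -⟩ | h
        · exact absurd h hv
        · exact h
      -- Replace `y` by a vertex `y'` of its component with `y'v` of colour `d t`. In the triangle
      -- `x y' v` the side `xy'` is not of colour `d t`, so it shares the colour `e` of `xv`.
      have fact3 : ∀ e ≠ d t, ∀ x ∈ W, c x v = e → ∀ y ∈ W,
          ¬ ReflTransGen (ColorAdj c (d t) W) x y → c x y = e := by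
        intro e he x hx hxv y hy hxy
        obtain ⟨y', hy', hr', hc'⟩ := fact2 y hy
        have hxy' : ¬ ReflTransGen (ColorAdj c (d t) W) x y' := fun h =>
          hxy (h.trans (reach_symm hs hr'))
        have h1 : c x y = c x y' := by
          rw [hs x y, hs x y']
          exact reach_color_eq (V := (W : Set α)) ht hx hr' fun h => hxy (reach_symm hs h)
        have hne : x ≠ y' := by rintro rfl; exact hxy' ReflTransGen.refl
        have h2 : c x y' ≠ d t := fun h => hxy' (ReflTransGen.single ⟨hx, hy', hne, h⟩)
        have hvx : x ≠ v := by rintro rfl; exact hv hx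
        have hvy : y' ≠ v := by rintro rfl; exact hv hy'
        rw [h1]
        rcases ht x y' v hne hvy hvx with h | h | h
        · exact absurd (h.trans hc') h2
        · rw [← h, hxv]
        · exact absurd ((hxv.symm.trans h).trans hc') he
      obtain ⟨x, hx, hxv⟩ := hadj t₁
      obtain ⟨x', hx', hxv'⟩ := hadj t₂
      have g1 := fact3 _ (fun e => h1 (hd e)) x hx hxv
      have g2 := fact3 _ (fun e => h2 (hd e)) x' hx' hxv'
      -- If `x` and `x'` share a component, an outside vertex `y` sees it in both colours `t₁` and
      -- `t₂`; otherwise the edge `xx'` itself would have both colours.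
      by_cases hxx : ReflTransGen (ColorAdj c (d t) W) x x'
      · obtain ⟨y, hy, hxy⟩ : ∃ y ∈ W, ¬ ReflTransGen (ColorAdj c (d t) W) x y := by
          by_contra! hall
          exact hn ((reach_symm hs (hall _ hy₀)).trans (hall _ hy₁))
        have e1 := g1 y hy hxy
        have e2 := g2 y hy fun h => hxy (hxx.trans h)
        have e3 := reach_color_eq (V := (W : Set α)) ht hy hxx hxy
        exact h12 (hd (e1.symm.trans (e3.trans e2)))
      · have e1 := g1 x' hx' hxx
        have e2 := g2 x hx fun h => hxx (reach_symm hs h)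
        rw [hs] at e2
        exact h12 (hd (e1.symm.trans e2))
    -- Here `W` has at most one vertex, and one edge at `v` cannot carry two colours.
    · obtain ⟨x, hx, h0⟩ := hadj 0
      obtain ⟨y, hy, h1⟩ := hadj 1
      have : x = y := Finset.card_le_one.1 (not_lt.1 hW) x hx y hy
      subst this
      exact absurd (hd (h0.symm.trans h1)) (by decide)

end Gallai

/-! ### Ordered colourings -/

/-- A colouring of the pairs of letters in which the colour of the long side of a triangle is that
of a short side. -/
structure IsColoring {N : ℕ} {C : Type*} (c : Fin N → Fin N → C) : Prop where
  symm : ∀ x y, c x y = c y x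
  tri : ∀ x y z, x < y → y < z → c x z = c x y ∨ c x z = c y z

/-- An equivalence relation with convex classes. -/
structure IsConvexEquiv {N : ℕ} (R : Fin N → Fin N → Prop) : Prop where
  equiv : Equivalence R
  convex : ∀ x y z, x ≤ y → y ≤ z → R x z → R x y

/-- The classes are homogeneous for the colouring. -/
def IsHomogeneous {N : ℕ} {C : Type*} (c : Fin N → Fin N → C) (R : Fin N → Fin N → Prop) : Prop :=
  ∀ x x' y, R x x' → ¬ R x y → c x y = c x' y

/-- The relation is stable under reversal of the letters. -/
def IsSymmRel {N : ℕ} (R : Fin N → Fin N → Prop) : Prop := ∀ x y, R x y → R x.rev y.rev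

/-- The relation is the equality or the full relation. -/
def IsTrivialRel {N : ℕ} (R : Fin N → Fin N → Prop) : Prop :=
  (∀ x y, R x y) ∨ ∀ x y, R x y → x = y

theorem IsColoring.no_rainbow {N : ℕ} {C : Type*} {c : Fin N → Fin N → C} (hc : IsColoring c)
    (x y z : Fin N) (hxy : x ≠ y) (hyz : y ≠ z) (hxz : x ≠ z) :
    c x y = c y z ∨ c x z = c x y ∨ c x z = c y z := by
  have hs := hc.symm
  have ht := hc.tri
  rcases lt_or_gt_of_ne hxy with h1 | h1 <;> rcases lt_or_gt_of_ne hyz with h2 | h2 <;>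
    rcases lt_or_gt_of_ne hxz with h3 | h3
  · have := ht x y z h1 h2; tauto
  · exact absurd (h1.trans h2) h3.asymm
  · have := ht x z y h3 h2; rw [hs z y] at this; tauto
  · have := ht z x y h3 h1; rw [hs z y, hs z x] at this; tauto
  · have := ht y x z h1 h3; rw [hs y x] at this; tauto
  · have := ht y z x h2 h3; rw [hs y x, hs z x] at this; tauto
  · exact absurd (h2.trans h1) h3.asymm
  · have := ht z y x h2 h1; rw [hs z y, hs z x, hs y x] at this; tauto

/-- If at least three colours occur, there is a nontrivial division into homogeneous intervals. -/
theorem IsColoring.exists_nontrivial {N : ℕ} {C : Type*} {c : Fin N → Fin N → C}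
    (hc : IsColoring c) (d : Fin 3 → C) (hd : Injective d)
    (hu : ∀ t, ∃ x y, x ≠ y ∧ c x y = d t) :
    ∃ R, IsConvexEquiv R ∧ IsHomogeneous c R ∧ ¬ IsTrivialRel R ∧
      ((∀ x y, c x.rev y.rev = c x y) → IsSymmRel R) := by
  by_contra hcon
  have hV : 1 < (Finset.univ : Finset (Fin N)).card := by
    obtain ⟨x, y, hxy, -⟩ := hu 0
    exact Finset.one_lt_card.2 ⟨x, Finset.mem_univ _, y, Finset.mem_univ _, hxy⟩
  refine not_three_connected hc.symm hc.no_rainbow d hd Finset.univ hV fun t x _ y _ => ?_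
  by_contra hxy
  rw [Finset.coe_univ] at hxy
  obtain ⟨u, v, huv, hcuv⟩ := hu t
  have hhom : IsHomogeneous c (ReflTransGen (ColorAdj c (d t) Set.univ)) := fun x x' y h hn =>
    reach_color_eq hc.no_rainbow (Set.mem_univ y) h hn
  refine hcon ⟨ReflTransGen (ColorAdj c (d t) Set.univ), ⟨reach_equivalence hc.symm, ?_⟩, hhom,
    ?_, ?_⟩
  · intro x y z hxy hyz hxz
    by_contra hn
    have hlt : x < y := lt_of_le_of_ne hxy (by rintro rfl; exact hn ReflTransGen.refl)
    -- A path from `x` cannot jump over `y`: for an edge with `b < y < b'`, the long side `bb'` has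
    -- the colour of `by` or `yb'`. These two colours agree by homogeneity, so `y` would be
    -- reachable.
    have key : ∀ b, ReflTransGen (ColorAdj c (d t) Set.univ) x b → b < y := by
      intro b hb
      induction hb with
      | refl => exact hlt
      | tail hr he ih =>
        rename_i b b'
        have hr' := hr.tail he
        by_contra hby
        have hyb : y < b' := lt_of_le_of_ne (not_lt.1 hby) (by rintro rfl; exact hn hr')
        have e1 : c b y = c b' y := hhom b b' y (ReflTransGen.single he) fun h => hn (hr.trans h)
        have e2 : c b y = d t := by
          rcases hc.tri b y b' ih hyb with h | h
          · rw [← h, he.2.2.2]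
          · rw [e1, hc.symm, ← h, he.2.2.2]
        exact hn (hr.tail ⟨trivial, trivial, ih.ne, e2⟩)
    exact absurd (key z hxz) (not_lt.2 hyz)
  · rintro (h | h)
    · exact hxy (h x y)
    · exact huv (h u v (ReflTransGen.single ⟨trivial, trivial, huv, hcuv⟩))
  · intro hrev x y hr
    refine ReflTransGen.lift (r := ColorAdj c (d t) Set.univ) Fin.rev ?_ _ _ hr
    rintro a b ⟨-, -, hne, hab⟩
    exact ⟨trivial, trivial, fun e => hne (Fin.rev_injective e), by rw [hrev, hab]⟩

/-- A decomposition of an inversion set gives a colouring; the uncoloured pairs get `none`. -/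
theorem exists_coloring {N r : ℕ} {w : Perm (Fin N)} {γ : Fin r → Perm (Fin N)}
    (hD : IsDisjointUnion (invA w) fun a => invA (γ a)) :
    ∃ c : Fin N → Fin N → Option (Fin r), IsColoring c ∧
      (∀ x y a, x < y → (c x y = some a ↔ γ a y < γ a x)) ∧
      (∀ x y, x < y → (c x y = none ↔ w x < w y)) ∧
      ((∀ a, IsSymm (γ a)) → ∀ x y, c x.rev y.rev = c x y) := by
  classical
  rw [isDisjointUnion_iff] at hD
  obtain ⟨hD1, hD2⟩ := hD
  have hex : ∀ p, ∃ o : Option (Fin r), ∀ a, o = some a ↔ p ∈ invA (γ a) := by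
    intro p
    by_cases h : ∃ a, p ∈ invA (γ a)
    · obtain ⟨a, ha⟩ := h
      refine ⟨some a, fun b => ?_⟩
      rw [Option.some_inj]
      exact ⟨fun e => e ▸ ha, fun hb => hD2 p a b ha hb⟩
    · refine ⟨none, fun a => ?_⟩
      simp only [reduceCtorEq, false_iff]
      exact fun ha => h ⟨a, ha⟩
  choose o ho using hex
  have hc : ∀ x y, x < y → o (min x y, max x y) = o (x, y) := fun x y h => by
    rw [min_eq_left h.le, max_eq_right h.le]
  have hsome : ∀ x y a, x < y → (o (min x y, max x y) = some a ↔ γ a y < γ a x) := by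
    intro x y a h
    rw [hc x y h, ho, mem_invA]
    simp [h]
  have hnone : ∀ x y, x < y → (o (min x y, max x y) = none ↔ w x < w y) := by
    intro x y h
    rw [hc x y h, Option.eq_none_iff_forall_ne_some, lt_iff_not_lt w h.ne]
    have := hD1 (x, y)
    rw [mem_invA] at this
    simp only [h, true_and] at this
    rw [this, not_exists]
    exact forall_congr' fun a => not_congr (ho _ a)
  refine ⟨fun x y => o (min x y, max x y), ⟨fun x y => by rw [min_comm, max_comm], ?_⟩, hsome,
    hnone, ?_⟩
  · intro x y z hxy hyz
    -- Transitivity in both cases: if neither short side is a non-inversion of `w` (or an inversion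
    -- of `γ a`), then the long side is not one either.
    rcases h : o (min x z, max x z) with _ | a
    · rw [hnone _ _ (hxy.trans hyz)] at h
      simp only [eq_comm (a := none), hnone _ _ hxy, hnone _ _ hyz]
      by_contra! hcon
      exact absurd (hcon.2.trans hcon.1) (not_le.2 h)
    · rw [hsome _ _ _ (hxy.trans hyz)] at h
      simp only [eq_comm (a := some a), hsome _ _ _ hxy, hsome _ _ _ hyz]
      by_contra! hcon
      exact absurd (hcon.1.trans hcon.2) (not_le.2 h)
  · intro hs x y
    ext a
    have : (min x.rev y.rev, max x.rev y.rev) = ((max x y).rev, (min x y).rev) := by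
      rcases le_total x y with h | h
      · rw [min_eq_right (Fin.rev_le_rev.2 h), max_eq_left (Fin.rev_le_rev.2 h), max_eq_right h,
          min_eq_left h]
      · rw [min_eq_left (Fin.rev_le_rev.2 h), max_eq_right (Fin.rev_le_rev.2 h), max_eq_left h,
          min_eq_right h]
    simp only [this]
    rw [ho, ho, (hs a).mem_invA]

/-! ### Divisions into intervals -/

theorem IsConvexEquiv.exists_monotone {N : ℕ} {R : Fin N → Fin N → Prop} (hR : IsConvexEquiv R) :
    ∃ (m : ℕ) (f : Fin N → Fin m), Monotone f ∧ Surjective f ∧ ∀ x y, f x = f y ↔ R x y := by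
  classical
  have hne : ∀ x, (Finset.univ.filter (R x)).Nonempty := fun x =>
    ⟨x, by simpa using hR.equiv.refl x⟩
  -- Each class is represented by its least element; convexity makes `μ` monotone, and the classes
  -- are numbered through the image of `μ`.
  let μ : Fin N → Fin N := fun x => (Finset.univ.filter (R x)).min' (hne x)
  have hμ : ∀ x, R x (μ x) := fun x => (Finset.mem_filter.1 (Finset.min'_mem _ (hne x))).2
  have hle : ∀ x y, R x y → μ x ≤ y := fun x y h =>
    Finset.min'_le _ _ (Finset.mem_filter.2 ⟨Finset.mem_univ _, h⟩)
  have hμR : ∀ x y, μ x = μ y ↔ R x y := by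
    intro x y
    constructor
    · intro h
      have := hμ x
      rw [h] at this
      exact hR.equiv.trans this (hR.equiv.symm (hμ y))
    · intro h
      have : R x = R y := by
        ext u
        exact ⟨fun h' => hR.equiv.trans (hR.equiv.symm h) h', fun h' => hR.equiv.trans h h'⟩
      simp only [μ, this]
  have hmono : Monotone μ := by
    intro x y hxy
    by_contra hlt
    rw [not_le] at hlt
    have h1 : R (μ y) x := hR.convex (μ y) x y (hlt.le.trans (hle x x (hR.equiv.refl x))) hxy
      (hR.equiv.symm (hμ y))
    have h2 : R x y := hR.equiv.symm (hR.equiv.trans (hμ y) h1)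
    exact hlt.ne ((hμR x y).2 h2).symm
  let S := Finset.univ.image μ
  let e := S.orderIsoOfFin rfl
  refine ⟨S.card, fun x => e.symm ⟨μ x, Finset.mem_image_of_mem _ (Finset.mem_univ x)⟩, ?_, ?_, ?_⟩
  · intro x y hxy
    exact e.symm.monotone (hmono hxy)
  · intro i
    obtain ⟨x, -, hx⟩ := Finset.mem_image.1 (e i).2
    exact ⟨x, by rw [OrderIso.symm_apply_eq]; exact Subtype.ext hx⟩
  · intro x y
    rw [e.symm.injective.eq_iff, Subtype.mk.injEq, hμR]

theorem Monotone.lt_iff_and_ne {N m : ℕ} {f : Fin N → Fin m} (hf : Monotone f) (x y : Fin N) :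
    f x < f y ↔ x < y ∧ f x ≠ f y := by
  constructor
  · intro h
    exact ⟨hf.reflect_lt h, h.ne⟩
  · rintro ⟨h, hne⟩
    exact lt_of_le_of_ne (hf h.le) hne

/-- Conjugating by both reversals induces a strictly increasing self-map of the classes, which must
be the identity. -/
theorem map_rev_of_isSymmRel {N m : ℕ} {f : Fin N → Fin m} (hf : Monotone f)
    (hs : Surjective f) (hr : ∀ x y, f x = f y → f x.rev = f y.rev) (x : Fin N) :
    f x.rev = (f x).rev := by
  have hr' : ∀ x y, f x.rev = f y.rev → f x = f y := fun x y h => by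
    simpa only [Fin.rev_rev] using hr _ _ h
  let g : Fin m → Fin m := fun b => (f (surjInv hs b).rev).rev
  have hg : ∀ x, g (f x) = (f x.rev).rev := fun x => by
    simp only [g]
    rw [hr _ x (surjInv_eq hs (f x))]
  have hm : StrictMono g := by
    intro b b' hlt
    obtain ⟨x, rfl⟩ := hs b
    obtain ⟨y, rfl⟩ := hs b'
    rw [hg, hg, Fin.rev_lt_rev]
    rw [Monotone.lt_iff_and_ne hf] at hlt ⊢
    exact ⟨Fin.rev_lt_rev.2 hlt.1, fun e => hlt.2 (hr' _ _ e).symm⟩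
  have := hg x
  rw [strictMono_fin_eq_id hm, id] at this
  rw [this, Fin.rev_rev]

theorem IsConvexEquiv.exists_symm_monotone {n : ℕ}
    {R : Fin (2 * n + 1) → Fin (2 * n + 1) → Prop} (hR : IsConvexEquiv R) (hs : IsSymmRel R) :
    ∃ (s : ℕ) (f : Fin (2 * n + 1) → Fin (2 * s + 1)), Monotone f ∧ Surjective f ∧
      (∀ x, f x.rev = (f x).rev) ∧ ∀ x y, f x = f y ↔ R x y := by
  obtain ⟨m, f, hf, hsf, hfR⟩ := hR.exists_monotone
  have hrev := map_rev_of_isSymmRel hf hsf fun x y h => (hfR _ _).2 (hs _ _ ((hfR _ _).1 h))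
  -- The middle letter is fixed by the reversal, so its class is fixed too; a fixed point of the
  -- reversal of `Fin m` forces `m` to be odd.
  have hc := hrev ⟨n, by omega⟩
  have hcc : (⟨n, by omega⟩ : Fin (2 * n + 1)).rev = ⟨n, by omega⟩ := by
    ext
    rw [Fin.val_rev]
    simp only
    omega
  rw [hcc, Fin.ext_iff, Fin.val_rev] at hc
  have hlt := (f ⟨n, by omega⟩).2
  obtain ⟨s, rfl⟩ : ∃ s, m = 2 * s + 1 := ⟨f ⟨n, by omega⟩, by omega⟩
  exact ⟨s, f, hf, hsf, hrev, hfR⟩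

/-- The sizes are the cardinalities of the fibres. Matching the `i`-th letter of a block with the
`i`-th element of the fibre is increasing, hence the identity, so blocks and fibres coincide. -/
theorem exists_blocks {N m : ℕ} {f : Fin N → Fin m} (hf : Monotone f) (hs : Surjective f) :
    ∃ (z : Fin m → ℕ) (h : ∑ b, z b = N), (∀ b, 0 < z b) ∧
      (∀ b i, f (blockEmb z h b i) = b) ∧ ((∀ x, f x.rev = (f x).rev) → ∀ b, z b = z b.rev) := by
  classical
  let S : Fin m → Finset (Fin N) := fun b => Finset.univ.filter fun x => f x = b
  have hS : ∀ x b, x ∈ S b ↔ f x = b := fun x b => by simp [S]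
  have hN : ∑ b, (S b).card = N := by
    have := Finset.card_eq_sum_card_fiberwise (f := f) (s := Finset.univ) (t := Finset.univ)
      (fun _ _ => Finset.mem_coe.2 (Finset.mem_univ _))
    rw [Finset.card_univ, Fintype.card_fin] at this
    exact this.symm
  refine ⟨fun b => (S b).card, hN, fun b => ?_, ?_, fun hr b => ?_⟩
  · obtain ⟨x, hx⟩ := hs b
    exact Finset.card_pos.2 ⟨x, (hS x b).2 hx⟩
  · let E : ∀ b, Fin (S b).card → Fin N := fun b i => (S b).orderIsoOfFin rfl i
    have hE : ∀ b i, f (E b i) = b := fun b i => (hS _ _).1 ((S b).orderIsoOfFin rfl i).2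
    have hex : ∀ x : Fin N, ∃ y : Fin N, ∀ b i, x = blockEmb (fun b => (S b).card) hN b i →
        y = E b i := by
      intro x
      obtain ⟨b, i, rfl⟩ := exists_blockEmb (fun b => (S b).card) hN x
      refine ⟨E b i, fun b' i' hx => ?_⟩
      by_cases hb : b = b'
      · subst hb
        rw [← blockEmb_injective b hx]
      · exact absurd hx (blockEmb_ne hb _ _)
    choose g hg using hex
    have hm : StrictMono g := by
      intro x y hxy
      obtain ⟨b, i, rfl⟩ := exists_blockEmb (fun b => (S b).card) hN x
      obtain ⟨b', j, rfl⟩ := exists_blockEmb (fun b => (S b).card) hN y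
      rw [hg _ b i rfl, hg _ b' j rfl]
      by_cases hb : b = b'
      · subst hb
        rw [blockEmb_lt_iff] at hxy
        exact ((S b).orderIsoOfFin rfl).strictMono hxy
      · rw [blockEmb_lt_iff_of_ne hb] at hxy
        apply hf.reflect_lt
        rwa [hE, hE]
    intro b i
    have := hg _ b i rfl
    rw [strictMono_fin_eq_id hm, id] at this
    rw [this, hE]
  · refine Finset.card_bij (fun x _ => x.rev) ?_ ?_ ?_
    · intro x hx
      rw [hS] at hx ⊢
      rw [hr, hx]
    · intro x _ y _ e
      exact Fin.rev_injective e
    · intro x hx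
      rw [hS] at hx
      exact ⟨x.rev, by rw [hS, hr, hx, Fin.rev_rev], Fin.rev_rev x⟩

theorem exists_isInfl_of_map {N m : ℕ} {f : Fin N → Fin m} {z : Fin m → ℕ} {h : ∑ b, z b = N}
    (hz : ∀ b, 0 < z b) (hfz : ∀ b i, f (blockEmb z h b i) = b) (w : Perm (Fin N))
    (hc : ∀ x x' y, f x = f x' → f x ≠ f y → (w x < w y ↔ w x' < w y)) :
    ∃ σ β, IsInfl z h w σ β := by
  refine exists_isInfl hz w fun b b' i i' j j' hb hlt => ?_
  have hne : ∀ i j, f (blockEmb z h b i) ≠ f (blockEmb z h b' j) := fun i j => by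
    rwa [hfz, hfz]
  rw [hc _ (blockEmb z h b i') _ (by rw [hfz, hfz]) (hne _ _)] at hlt
  by_contra hcon
  have hN : blockEmb z h b i' ≠ blockEmb z h b' j' := blockEmb_ne hb _ _
  rw [lt_iff_not_lt w hN, not_not, hc _ (blockEmb z h b' j) _ (by rw [hfz, hfz])
    (hne _ _).symm] at hcon
  exact hlt.asymm hcon

theorem isInfl_lt_iff {N m : ℕ} {f : Fin N → Fin m} {z : Fin m → ℕ} {h : ∑ b, z b = N}
    (hfz : ∀ b i, f (blockEmb z h b i) = b) {w : Perm (Fin N)} {σ : Perm (Fin m)}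
    {β : ∀ b, Perm (Fin (z b))} (hw : IsInfl z h w σ β) (x y : Fin N) (hne : f x ≠ f y) :
    σ (f x) < σ (f y) ↔ w x < w y := by
  obtain ⟨b, i, rfl⟩ := exists_blockEmb z h x
  obtain ⟨b', j, rfl⟩ := exists_blockEmb z h y
  rw [hfz, hfz] at hne ⊢
  exact (hw.ne _ _ _ _ hne).symm

/-! ### Simplicity and minus-decomposability -/

/-- The classes are sent to intervals by the permutation. -/
def IsCompatible {N : ℕ} (w : Perm (Fin N)) (R : Fin N → Fin N → Prop) : Prop :=
  ∀ x x' y, R x x' → ¬ R x y → (w x < w y ↔ w x' < w y)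

/-- Only the trivial symmetric divisions into intervals are compatible with the permutation. -/
def HasTrivialBlocks {N : ℕ} (w : Perm (Fin N)) : Prop :=
  ∀ R, IsConvexEquiv R → IsSymmRel R → IsCompatible w R → IsTrivialRel R

theorem IsConvexEquiv.lt_iff {N : ℕ} {R : Fin N → Fin N → Prop} (hR : IsConvexEquiv R)
    {x x' y : Fin N} (h : R x x') (hn : ¬ R x y) : x < y ↔ x' < y := by
  have hn' : ¬ R x' y := fun h' => hn (hR.equiv.trans h h')
  constructor
  · intro hlt
    by_contra hge
    exact hn (hR.convex x y x' hlt.le (not_lt.1 hge) h)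
  · intro hlt
    by_contra hge
    exact hn' (hR.convex x' y x hlt.le (not_lt.1 hge) (hR.equiv.symm h))

/-- Symmetric inflations of `tilde σ` and symmetric compatible interval relations are the same data:
the classes are the blocks. The full relation corresponds to `s = 0` and equality to `s = n`. -/
theorem isSimpleB_iff {n : ℕ} {σ : WeylB n} : IsSimpleB σ ↔ HasTrivialBlocks (tilde σ) := by
  constructor
  · intro hσ R hR hs hc
    obtain ⟨s, f, hf, hsf, hr, hfR⟩ := hR.exists_symm_monotone hs
    obtain ⟨z, h, hz, hfz, hzs⟩ := exists_blocks hf hsf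
    obtain ⟨σ₀, β, hi⟩ := exists_isInfl_of_map hz hfz (tilde σ) fun x x' y h1 h2 =>
      hc x x' y ((hfR _ _).1 h1) fun h3 => h2 ((hfR _ _).2 h3)
    obtain ⟨τ, rfl⟩ := exists_tilde_eq (hi.isSymm_perm (hzs hr) hz (isSymm_tilde σ))
    rcases hσ s τ z β (isInflation_iff.2 ⟨hz, h, hi⟩)
      (hi.isSymmetricFamily (hzs hr) (isSymm_tilde σ)) with rfl | rfl
    · exact Or.inl fun x y => (hfR x y).1 (Subsingleton.elim (α := Fin 1) _ _)
    · exact Or.inr fun x y h => (Finite.injective_iff_surjective.2 hsf) ((hfR x y).2 h)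
  · intro hσ s σ₀ z β hi hsym
    obtain ⟨hz, h, hi⟩ := isInflation_iff.1 hi
    obtain ⟨hzs, -⟩ := hsym
    have hex : ∀ x : Fin (2 * n + 1), ∃ b : Fin (2 * s + 1), ∀ b' i, x = blockEmb z h b' i →
        b = b' := by
      intro x
      obtain ⟨b, i, rfl⟩ := exists_blockEmb z h x
      refine ⟨b, fun b' i' hx => ?_⟩
      by_contra hb
      exact blockEmb_ne hb _ _ hx
    choose f hf using hex
    have hfz : ∀ b i, f (blockEmb z h b i) = b := fun b i => hf _ b i rfl
    have hmono : Monotone f := by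
      intro x y hxy
      obtain ⟨b, i, rfl⟩ := exists_blockEmb z h x
      obtain ⟨b', j, rfl⟩ := exists_blockEmb z h y
      rw [hfz, hfz]
      by_contra hb
      exact absurd hxy (not_le.2 (blockEmb_lt_of_lt (not_le.1 hb) j i))
    have hsurj : Surjective f := fun b => ⟨blockEmb z h b ⟨0, hz b⟩, hfz _ _⟩
    have hr : ∀ x, f x.rev = (f x).rev := by
      intro x
      obtain ⟨b, i, rfl⟩ := exists_blockEmb z h x
      rw [← blockEmb_rev hzs, hfz, hfz]
    rcases hσ (fun x y => f x = f y) ⟨⟨fun _ => rfl, fun h => h.symm, fun h h' => h.trans h'⟩,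
      fun x y z h1 h2 h3 => le_antisymm (hmono h1) (h3 ▸ hmono h2)⟩
      (fun x y (h : f x = f y) => (by rw [hr, hr, h] : f x.rev = f y.rev))
      (fun x x' y h1 h2 => by
        rw [← isInfl_lt_iff hfz hi _ _ h2, ← isInfl_lt_iff hfz hi _ _ (h1 ▸ h2), h1])
      with hall | hinj
    · left
      obtain ⟨x, hx⟩ := hsurj 0
      obtain ⟨y, hy⟩ := hsurj (Fin.last _)
      have : f x = f y := hall x y
      rw [hx, hy, Fin.ext_iff] at this
      simpa using this.symm
    · right
      have := Fintype.card_of_bijective (f := f) ⟨fun x y h => hinj x y h, hsurj⟩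
      rw [Fintype.card_fin, Fintype.card_fin] at this
      omega

/-- The cut `p` is the size of the first block: every letter before it exceeds in value every letter
after it. -/
theorem minusDecomposable_iff {N : ℕ} {w : Perm (Fin N)} : MinusDecomposable w ↔
    ∃ p : ℕ, 0 < p ∧ p < N ∧ ∀ x y : Fin N, (x : ℕ) < p → p ≤ (y : ℕ) → w y < w x := by
  constructor
  · rintro ⟨z, β, hi⟩
    obtain ⟨hz, rfl, hi⟩ := isInflation_iff.1 hi
    have hv0 : ∀ i, (blockEmb z rfl 0 i : ℕ) = i := fun i => by
      simp [blockEmb, finSigmaFinEquiv_apply]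
    have hv1 : ∀ i, (blockEmb z rfl 1 i : ℕ) = z 0 + i := fun i => by
      simp [blockEmb, finSigmaFinEquiv_apply]
    refine ⟨z 0, hz 0, by rw [Fin.sum_univ_two]; have := hz 1; omega, ?_⟩
    intro x y hx hy
    obtain ⟨b, i, rfl⟩ := exists_blockEmb z rfl x
    obtain ⟨b', j, rfl⟩ := exists_blockEmb z rfl y
    have hb : b = 0 := by
      by_contra hb
      obtain rfl : b = 1 := by omega
      rw [hv1] at hx
      omega
    have hb' : b' = 1 := by
      by_contra hb
      obtain rfl : b' = 0 := by omega
      rw [hv0] at hy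
      omega
    subst hb hb'
    rw [hi.ne _ _ _ _ (by decide)]
    decide
  · rintro ⟨p, hp, hpN, hw⟩
    have hN : 0 < N := by omega
    let f : Fin N → Fin 2 := fun x => if (x : ℕ) < p then 0 else 1
    have hf : Monotone f := by
      intro x y hxy
      have : (x : ℕ) ≤ y := hxy
      simp only [f]
      split_ifs
      · exact le_rfl
      · exact Fin.zero_le _
      · omega
      · exact le_rfl
    have hs : Surjective f := by
      intro b
      fin_cases b
      · exact ⟨⟨0, hN⟩, if_pos hp⟩
      · exact ⟨⟨p, hpN⟩, if_neg (lt_irrefl p)⟩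
    have hfw : ∀ x y, f x < f y → w y < w x := by
      intro x y hlt
      simp only [f] at hlt
      split_ifs at hlt with h1 h2
      · simp at hlt
      · exact hw x y h1 (not_lt.1 h2)
      · exact absurd hlt (by decide)
      · simp at hlt
    have hfw' : ∀ x y, f x ≠ f y → (w x < w y ↔ f y < f x) := by
      intro x y hne
      constructor
      · intro h
        by_contra hc
        exact h.asymm (hfw x y (lt_of_le_of_ne (not_lt.1 hc) hne))
      · exact hfw y x
    obtain ⟨z, h, hz, hfz, -⟩ := exists_blocks hf hs
    obtain ⟨σ, β, hi⟩ := exists_isInfl_of_map hz hfz w fun x x' y h1 h2 => by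
      rw [hfw' _ _ h2, hfw' _ _ (h1 ▸ h2), h1]
    have hσ : σ = longest 2 := by
      apply perm_ext_of_lt
      intro b b' hlt
      obtain ⟨x, rfl⟩ := hs b
      obtain ⟨y, rfl⟩ := hs b'
      have hne : f x ≠ f y := by rintro e; rw [e] at hlt; exact lt_irrefl _ hlt
      rw [isInfl_lt_iff hfz hi _ _ hne, hfw' _ _ hne] at hlt
      rw [longest_apply, longest_apply, Fin.rev_lt_rev]
      exact hlt
    subst hσ
    exact ⟨z, β, isInflation_iff.2 ⟨hz, h, hi⟩⟩

/-! ### Maximal homogeneous intervals -/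

/-- An interval that is homogeneous for the colouring. -/
structure IsModule {N : ℕ} {C : Type*} (c : Fin N → Fin N → C) (S : Set (Fin N)) : Prop where
  convex : ∀ x y z, x ∈ S → z ∈ S → x ≤ y → y ≤ z → y ∈ S
  color_eq : ∀ x y y', x ∉ S → y ∈ S → y' ∈ S → c x y = c x y'

/-- All pairs across some cut have the same colour. -/
def HasMonochromaticCut {N : ℕ} {C : Type*} (c : Fin N → Fin N → C) : Prop :=
  ∃ p : ℕ, 0 < p ∧ p < N ∧ ∃ d, ∀ x y : Fin N, (x : ℕ) < p → p ≤ (y : ℕ) → c x y = d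

section modules

variable {N : ℕ} {C : Type*} {c : Fin N → Fin N → C} {S T : Set (Fin N)}

theorem exists_cut_of_isUpperSet (hN : 0 < N) (h0 : (⟨0, hN⟩ : Fin N) ∉ T) (hT : T.Nonempty)
    (hup : ∀ x y, x ∈ T → x ≤ y → y ∈ T) :
    ∃ p : ℕ, 0 < p ∧ p < N ∧ ∀ x : Fin N, (x ∈ T ↔ p ≤ (x : ℕ)) := by
  classical
  have hex : ∃ k : ℕ, ∃ hk : k < N, (⟨k, hk⟩ : Fin N) ∈ T := by
    obtain ⟨x, hx⟩ := hT
    exact ⟨x, x.2, hx⟩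
  obtain ⟨hp, hpT⟩ := Nat.find_spec hex
  refine ⟨Nat.find hex, ?_, hp, fun x => ⟨fun hx => Nat.find_min' hex ⟨x.2, hx⟩, fun hx =>
    hup _ x hpT hx⟩⟩
  rw [Nat.find_pos]
  rintro ⟨_, h⟩
  exact h0 h

/-- `S` contains the first letter but not the last, and `T` the reverse, so `T` is a final segment
starting at some `p`. For `x < p ≤ y`, homogeneity of `T` moves `y` to the last letter and
homogeneity of `S` moves `x` to the first one. -/
theorem IsModule.hasMonochromaticCut (hs : ∀ x y, c x y = c y x) (hN : 0 < N) (hS : IsModule c S)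
    (hT : IsModule c T) (hS1 : S ≠ Set.univ) (hT1 : T ≠ Set.univ) (hu : S ∪ T = Set.univ)
    (h0 : (⟨0, hN⟩ : Fin N) ∈ S) : HasMonochromaticCut c := by
  have hU : ∀ x, x ∈ S ∨ x ∈ T := fun x => by
    rw [← Set.mem_union, hu]
    trivial
  have hle : ∀ x : Fin N, (⟨0, hN⟩ : Fin N) ≤ x := fun x => Nat.zero_le _
  have hge : ∀ x : Fin N, x ≤ ⟨N - 1, by omega⟩ := fun x => by
    rw [Fin.le_def]
    have := x.2
    simp only
    omega
  have hlast : (⟨N - 1, by omega⟩ : Fin N) ∉ S := fun h =>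
    hS1 (Set.eq_univ_of_forall fun x => hS.convex _ x _ h0 h (hle x) (hge x))
  have hlast' := (hU _).resolve_left hlast
  have h0' : (⟨0, hN⟩ : Fin N) ∉ T := fun h =>
    hT1 (Set.eq_univ_of_forall fun x => hT.convex _ x _ h hlast' (hle x) (hge x))
  obtain ⟨p, hp, hpN, hpT⟩ := exists_cut_of_isUpperSet hN h0' ⟨_, hlast'⟩ fun x y hx hxy =>
    hT.convex _ _ _ hx hlast' hxy (hge y)
  refine ⟨p, hp, hpN, c ⟨N - 1, by omega⟩ ⟨0, hN⟩, fun x y hx hy => ?_⟩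
  have hxT : x ∉ T := fun h => absurd ((hpT x).1 h) (not_le.2 hx)
  rw [hT.color_eq x y _ hxT ((hpT y).2 hy) hlast', hs,
    hS.color_eq _ x _ hlast ((hU x).resolve_right hxT) h0]

theorem IsModule.union (hS : IsModule c S) (hT : IsModule c T) {u : Fin N} (huS : u ∈ S)
    (huT : u ∈ T) : IsModule c (S ∪ T) := by
  constructor
  · intro x y z hx hz hxy hyz
    rcases le_total y u with h | h
    · exact hx.imp (fun hx => hS.convex x y u hx huS hxy h) fun hx => hT.convex x y u hx huT hxy h
    · exact hz.imp (fun hz => hS.convex u y z huS hz h hyz) fun hz => hT.convex u y z huT hz h hyz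
  · intro x y y' hx hy hy'
    have key : ∀ y, y ∈ S ∪ T → c x y = c x u := by
      rintro y (hy | hy)
      · exact hS.color_eq x y u (fun h => hx (Or.inl h)) hy huS
      · exact hT.color_eq x y u (fun h => hx (Or.inr h)) hy huT
    rw [key y hy, key y' hy']

/-- Without monochromatic cuts, the maximal proper homogeneous intervals form a division. -/
theorem exists_maximal_homogeneous (hs : ∀ x y, c x y = c y x) (hN : 2 ≤ N)
    (hcut : ¬ HasMonochromaticCut c) :
    ∃ R, IsConvexEquiv R ∧ IsHomogeneous c R ∧ ((∀ x y, c x.rev y.rev = c x y) → IsSymmRel R) ∧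
      (¬ ∀ x y, R x y) ∧ ∀ R', IsConvexEquiv R' → IsHomogeneous c R' → (∀ x y, R x y → R' x y) →
        (∀ x y, R' x y) ∨ ∀ x y, R' x y → R x y := by
  have hN0 : 0 < N := by omega
  -- Related letters are those lying in a common proper module; the absence of monochromatic cuts
  -- makes this transitive.
  let R : Fin N → Fin N → Prop := fun x y => ∃ S, IsModule c S ∧ S ≠ Set.univ ∧ x ∈ S ∧ y ∈ S
  have hle : ∀ x : Fin N, (⟨0, hN0⟩ : Fin N) ≤ x := fun x => Nat.zero_le _
  have hge : ∀ x : Fin N, x ≤ ⟨N - 1, by omega⟩ := fun x => by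
    rw [Fin.le_def]
    have := x.2
    simp only
    omega
  have hrefl : ∀ x, R x x := by
    intro x
    refine ⟨{x}, ⟨?_, ?_⟩, ?_, rfl, rfl⟩
    · rintro a b d rfl rfl h1 h2
      exact le_antisymm h2 h1
    · rintro a y y' - rfl rfl
      rfl
    · intro h
      have h1 : (⟨0, by omega⟩ : Fin N) ∈ ({x} : Set (Fin N)) := h ▸ trivial
      have h2 : (⟨1, by omega⟩ : Fin N) ∈ ({x} : Set (Fin N)) := h ▸ trivial
      rw [Set.mem_singleton_iff] at h1 h2
      have := h1.trans h2.symm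
      simp at this
  refine ⟨R, ⟨⟨hrefl, ?_, ?_⟩, ?_⟩, ?_, ?_, ?_, ?_⟩
  · rintro x y ⟨S, h1, h2, h3, h4⟩
    exact ⟨S, h1, h2, h4, h3⟩
  · rintro x y z ⟨S, hS, hS1, hx, hy⟩ ⟨T, hT, hT1, hy', hz⟩
    -- Modules with a common letter have a module as union. It is proper, since two proper modules
    -- covering everything would produce a monochromatic cut.
    refine ⟨S ∪ T, hS.union hT hy hy', fun hu => hcut ?_, Or.inl hx, Or.inr hz⟩
    have h0 : (⟨0, hN0⟩ : Fin N) ∈ S ∪ T := hu ▸ trivial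
    rcases h0 with h0 | h0
    · exact hS.hasMonochromaticCut hs hN0 hT hS1 hT1 hu h0
    · exact hT.hasMonochromaticCut hs hN0 hS hT1 hS1 (by rw [Set.union_comm, hu]) h0
  · rintro x y z hxy hyz ⟨S, hS, hS1, hx, hz⟩
    exact ⟨S, hS, hS1, hx, hS.convex x y z hx hz hxy hyz⟩
  · rintro x x' y ⟨S, hS, hS1, hx, hx'⟩ hn
    have hy : y ∉ S := fun hy => hn ⟨S, hS, hS1, hx, hy⟩
    rw [hs x, hs x', hS.color_eq y x x' hy hx hx']
  · rintro hrev x y ⟨S, hS, hS1, hx, hy⟩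
    refine ⟨Fin.rev ⁻¹' S, ⟨?_, ?_⟩, ?_, by simpa using hx, by simpa using hy⟩
    · intro a b d ha hd hab hbd
      exact hS.convex d.rev b.rev a.rev hd ha (Fin.rev_le_rev.2 hbd) (Fin.rev_le_rev.2 hab)
    · intro a b b' ha hb hb'
      rw [← hrev a b, ← hrev a b']
      exact hS.color_eq _ _ _ ha hb hb'
    · intro hu
      refine hS1 (Set.eq_univ_of_forall fun a => ?_)
      have : a.rev ∈ Fin.rev ⁻¹' S := hu ▸ trivial
      simpa using this
  · intro hall
    obtain ⟨S, hS, hS1, h0, h1⟩ := hall ⟨0, hN0⟩ ⟨N - 1, by omega⟩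
    exact hS1 (Set.eq_univ_of_forall fun x => hS.convex _ x _ h0 h1 (hle x) (hge x))
  · intro R' hR' hc' _
    by_cases hall : ∀ x y, R' x y
    · exact Or.inl hall
    · right
      intro x y hxy
      -- Maximality: a class of `R'` is a module, and it is proper unless `R'` is full.
      refine ⟨{u | R' x u}, ⟨?_, ?_⟩, fun hu => hall fun a b => ?_, hR'.equiv.refl x, hxy⟩
      · intro a b d ha hd hab hbd
        exact hR'.equiv.trans ha
          (hR'.convex a b d hab hbd (hR'.equiv.trans (hR'.equiv.symm ha) hd))
      · intro a b b' ha hb hb'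
        rw [hs a b, hs a b']
        exact hc' b b' a (hR'.equiv.trans (hR'.equiv.symm hb) hb') fun h =>
          ha (hR'.equiv.trans hb h)
      · have ha : a ∈ {u | R' x u} := hu ▸ trivial
        have hb : b ∈ {u | R' x u} := hu ▸ trivial
        exact hR'.equiv.trans (hR'.equiv.symm ha) hb

/-- The quotient of a symmetric colouring without monochromatic cuts by its maximal proper
homogeneous intervals has only trivial homogeneous divisions and uses exactly two colours. -/
theorem exists_prime_quotient {n : ℕ} {c : Fin (2 * n + 1) → Fin (2 * n + 1) → C} (hn : 1 ≤ n)
    (hc : IsColoring c) (hrev : ∀ x y, c x.rev y.rev = c x y) (hcut : ¬ HasMonochromaticCut c) :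
    ∃ (s : ℕ) (f : Fin (2 * n + 1) → Fin (2 * s + 1)), 2 ≤ s ∧ Monotone f ∧ Surjective f ∧
      (∀ x, f x.rev = (f x).rev) ∧ (∀ x x' y, f x = f x' → f x ≠ f y → c x y = c x' y) ∧
      (∀ R', IsConvexEquiv R' →
        (∀ x x' y, R' (f x) (f x') → ¬ R' (f x) (f y) → c x y = c x' y) → IsTrivialRel R') ∧
      ∃ d₁ d₂, d₁ ≠ d₂ ∧ (∀ x y, f x ≠ f y → c x y = d₁ ∨ c x y = d₂) ∧
        (∃ x y, x < y ∧ f x ≠ f y ∧ c x y = d₁) ∧ ∃ x y, x < y ∧ f x ≠ f y ∧ c x y = d₂ := by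
  obtain ⟨R, hR, hRc, hRs, hRne, hRmax⟩ := exists_maximal_homogeneous hc.symm (by omega) hcut
  obtain ⟨s, f, hf, hsf, hfr, hfR⟩ := hR.exists_symm_monotone (hRs hrev)
  have hhom : ∀ x x' y, f x = f x' → f x ≠ f y → c x y = c x' y := fun x x' y h1 h2 =>
    hRc x x' y ((hfR _ _).1 h1) fun h => h2 ((hfR _ _).2 h)
  have htriv : ∀ R', IsConvexEquiv R' →
      (∀ x x' y, R' (f x) (f x') → ¬ R' (f x) (f y) → c x y = c x' y) → IsTrivialRel R' := by
    intro R' hR' hc'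
    rcases hRmax (fun x y => R' (f x) (f y)) ⟨⟨fun x => hR'.equiv.refl _,
      fun h => hR'.equiv.symm h, fun h h' => hR'.equiv.trans h h'⟩, fun x y z h1 h2 h =>
        hR'.convex _ _ _ (hf h1) (hf h2) h⟩ hc'
      (fun x y h => (by rw [(hfR x y).2 h]; exact hR'.equiv.refl _ : R' (f x) (f y))) with h | h
    · left
      intro a b
      obtain ⟨x, rfl⟩ := hsf a
      obtain ⟨y, rfl⟩ := hsf b
      exact h x y
    · right
      intro a b hab
      obtain ⟨x, rfl⟩ := hsf a
      obtain ⟨y, rfl⟩ := hsf b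
      exact (hfR x y).2 (h x y hab)
  let g := surjInv hsf
  have hg : ∀ b, f (g b) = b := surjInv_eq hsf
  let c' : Fin (2 * s + 1) → Fin (2 * s + 1) → C := fun b b' => c (g b) (g b')
  have hcc' : ∀ x y, f x ≠ f y → c x y = c' (f x) (f y) := by
    intro x y hxy
    have h1 : c x y = c (g (f x)) y := hhom _ _ _ (by rw [hg]) hxy
    have h2 : c y (g (f x)) = c (g (f y)) (g (f x)) :=
      hhom _ _ _ (by rw [hg]) (by rw [hg]; exact hxy.symm)
    rw [h1, hc.symm, h2, hc.symm]
  have hc' : IsColoring c' := ⟨fun _ _ => hc.symm _ _, fun a b d hab hbd =>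
    hc.tri _ _ _ (hf.reflect_lt (by rwa [hg, hg])) (hf.reflect_lt (by rwa [hg, hg]))⟩
  have hcrev : ∀ a b, a ≠ b → c' a.rev b.rev = c' a b := by
    intro a b hab
    have h1 : ∀ b, f (g b).rev = b.rev := fun b => by rw [hfr, hg]
    have := hcc' (g a).rev (g b).rev (by rw [h1, h1]; simpa using hab)
    rw [h1, h1, hrev] at this
    exact this.symm
  obtain ⟨x₀, y₀, h₀⟩ : ∃ x y, ¬ R x y := by simpa using hRne
  have h₀ : f x₀ ≠ f y₀ := fun h => h₀ ((hfR _ _).1 h)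
  -- A second colour must occur between classes: otherwise the end of the first class would be a
  -- monochromatic cut.
  obtain ⟨x₁, y₁, hne₁, hd⟩ : ∃ x y, f x ≠ f y ∧ c x y ≠ c x₀ y₀ := by
    by_contra! hcon
    apply hcut
    have hn0 : 0 < 2 * n + 1 := by omega
    obtain ⟨p, hp, hpN, hpT⟩ := exists_cut_of_isUpperSet (T := {x | f ⟨0, hn0⟩ ≠ f x}) hn0
      (fun h => h rfl) (by
        by_contra hemp
        rw [Set.not_nonempty_iff_eq_empty, Set.eq_empty_iff_forall_notMem] at hemp
        have hx := hemp x₀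
        have hy := hemp y₀
        simp only [Set.mem_ofPred_eq, not_not] at hx hy
        exact h₀ (hx.symm.trans hy)) (by
        intro x y hx hxy hy
        have h1 : f x ≤ f y := hf hxy
        rw [← hy] at h1
        exact hx (le_antisymm (hf (Nat.zero_le _)) h1))
    refine ⟨p, hp, hpN, c x₀ y₀, fun x y hx hy => hcon x y ?_⟩
    have h1 : f ⟨0, hn0⟩ = f x := by
      by_contra h
      exact absurd ((hpT x).1 h) (not_le.2 hx)
    rw [← h1]
    exact (hpT y).2 hy
  have htwo : ∀ x y, f x ≠ f y → c x y = c x₀ y₀ ∨ c x y = c x₁ y₁ := by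
    intro x y hxy
    -- A third colour would give, by Gallai, a nontrivial homogeneous division of the quotient,
    -- contrary to maximality.
    by_contra! hcon
    obtain ⟨R', hR', hRc', hRt', -⟩ := hc'.exists_nontrivial ![c x₀ y₀, c x₁ y₁, c x y] (by
      intro i j hij
      have a1 := hcon.1
      have a2 := hcon.2
      fin_cases i <;> fin_cases j <;> simp at hij <;> first | rfl | (exfalso; tauto)) (by
      intro t
      fin_cases t
      · exact ⟨_, _, h₀, (hcc' _ _ h₀).symm⟩
      · exact ⟨_, _, hne₁, (hcc' _ _ hne₁).symm⟩
      · exact ⟨_, _, hxy, (hcc' _ _ hxy).symm⟩)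
    refine hRt' (htriv R' hR' fun a a' b h1 h2 => ?_)
    have hab : f a ≠ f b := fun e => h2 (e ▸ hR'.equiv.refl _)
    have hab' : f a' ≠ f b := fun e => h2 (e ▸ h1)
    rw [hcc' _ _ hab, hcc' _ _ hab']
    exact hRc' _ _ _ h1 h2
  have hs2 : 2 ≤ s := by
    by_contra hlt
    obtain rfl | rfl : s = 0 ∨ s = 1 := by omega
    · exact h₀ (Subsingleton.elim (α := Fin 1) _ _)
    -- With three classes the symmetry equates the two short sides of the only triangle, hence all
    -- three sides, leaving no room for a second colour.
    · have e1 : c' 1 2 = c' 0 1 := hcrev (0 : Fin 3) 1 (by decide) ▸ hc'.symm _ _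
      have e2 : c' 0 2 = c' 0 1 := by
        rcases hc'.tri 0 1 2 (by decide) (by decide) with h | h
        · exact h
        · rw [h, e1]
      have key : ∀ a b : Fin 3, a ≠ b → c' a b = c' 0 1 := by
        intro a b hab
        fin_cases a <;> fin_cases b
        · exact absurd rfl hab
        · rfl
        · exact e2
        · exact hc'.symm _ _
        · exact absurd rfl hab
        · exact e1
        · exact (hc'.symm _ _).trans e2
        · exact (hc'.symm _ _).trans e1
        · exact absurd rfl hab
      apply hd
      rw [hcc' _ _ h₀, hcc' _ _ hne₁, key _ _ h₀, key _ _ hne₁]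
  have hord : ∀ x y, f x ≠ f y → ∃ x' y', x' < y' ∧ f x' ≠ f y' ∧ c x' y' = c x y := by
    intro x y hxy
    rcases lt_trichotomy x y with h | rfl | h
    · exact ⟨x, y, h, hxy, rfl⟩
    · exact absurd rfl hxy
    · exact ⟨y, x, h, hxy.symm, hc.symm _ _⟩
  exact ⟨s, f, hs2, hf, hsf, hfr, hhom, htriv, _, _, hd.symm, htwo, hord _ _ h₀, hord _ _ hne₁⟩

end modules

/-! ### Existence of the inflation form -/

theorem isInfl_longest {N m : ℕ} {z : Fin m → ℕ} {h : ∑ b, z b = N} :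
    IsInfl z h (longest N) (longest m) fun b => longest (z b) := by
  constructor
  · intro b i j
    rw [longest_apply, longest_apply, longest_apply, longest_apply, Fin.rev_lt_rev,
      Fin.rev_lt_rev, blockEmb_lt_iff]
  · intro b b' i j hb
    rw [longest_apply, longest_apply, longest_apply, longest_apply, Fin.rev_lt_rev,
      Fin.rev_lt_rev, blockEmb_lt_iff_of_ne hb.symm]

theorem exists_inflation_family {n r s : ℕ} (w : Fin r → WeylB n)
    {f : Fin (2 * n + 1) → Fin (2 * s + 1)} (hf : Monotone f) (hs : Surjective f)
    (hr : ∀ x, f x.rev = (f x).rev)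
    (hc : ∀ a x x' y, f x = f x' → f x ≠ f y →
      (tilde (w a) x < tilde (w a) y ↔ tilde (w a) x' < tilde (w a) y))
    (hD : IsDisjointUnion (posRootsA (2 * n + 1)) fun a => invA (tilde (w a))) :
    ∃ (σ : Fin r → WeylB s) (z : Fin (2 * s + 1) → ℕ) (β : Fin r → ∀ b, Perm (Fin (z b))),
      (∀ a, IsInflation (tilde (w a)) (tilde (σ a)) z (β a)) ∧
      (∀ a, IsSymmetricFamily z (β a)) ∧
      (∀ b, IsDisjointUnion (posRootsA (z b)) fun a => invA (β a b)) ∧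
      ∀ a x y, f x ≠ f y →
        (tilde (σ a) (f x) < tilde (σ a) (f y) ↔ tilde (w a) x < tilde (w a) y) := by
  obtain ⟨z, h, hz, hfz, hzs⟩ := exists_blocks hf hs
  choose σ' β hi using fun a => exists_isInfl_of_map hz hfz (tilde (w a)) (hc a)
  choose σ hσ using fun a => exists_tilde_eq ((hi a).isSymm_perm (hzs hr) hz (isSymm_tilde (w a)))
  simp only [← hσ] at hi
  refine ⟨σ, z, β, fun a => isInflation_iff.2 ⟨hz, h, hi a⟩,
    fun a => (hi a).isSymmetricFamily (hzs hr) (isSymm_tilde (w a)), fun b => ?_,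
    fun a x y hne => isInfl_lt_iff hfz (hi a) x y hne⟩
  -- The set of all pairs is the inversion set of the longest element, itself an inflation with
  -- longest pieces, so restricting the decomposition to a block gives (†).
  rw [← invA_longest] at hD ⊢
  exact isInfl_longest.isDisjointUnion_family hi hD b

theorem exists_perm_pair {r : ℕ} {i j a b : Fin r} (hij : i ≠ j) (hab : a ≠ b) :
    ∃ π : Perm (Fin r), π i = a ∧ π j = b := by
  refine ⟨swap i a * swap j (swap i a b), ?_, ?_⟩
  · rw [Perm.mul_apply, swap_apply_of_ne_of_ne hij, swap_apply_left]
    intro h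
    have := congrArg (swap i a) h
    rw [swap_apply_left, swap_apply_self] at this
    exact hab this
  · rw [Perm.mul_apply, swap_apply_left, swap_apply_self]

/-- The comparisons of a member of a decomposition in terms of the colouring. -/
theorem lt_iff_color {N : ℕ} {C : Type*} {c : Fin N → Fin N → Option C} (hc : IsColoring c)
    {w : Perm (Fin N)} {a : C} (hw : ∀ x y, x < y → (c x y = some a ↔ w y < w x)) {x y : Fin N}
    (hxy : x ≠ y) : w x < w y ↔ (x < y ↔ c x y ≠ some a) := by
  rcases lt_or_gt_of_ne hxy with h | h
  · rw [lt_iff_not_lt _ hxy, ← hw x y h]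
    simp [h]
  · rw [← hw y x h, hc.symm y x]
    simp [h.asymm]

/-- The facts about the colouring attached to a decomposition of the set of all pairs. -/
theorem exists_total_coloring {N r : ℕ} {w : Fin r → Perm (Fin N)} (hw : ∀ a, IsSymm (w a))
    (hD : IsDisjointUnion (posRootsA N) fun a => invA (w a)) :
    ∃ c : Fin N → Fin N → Option (Fin r), IsColoring c ∧ (∀ x y, c x.rev y.rev = c x y) ∧
      (∀ x y, x ≠ y → c x y ≠ none) ∧
      (∀ x y a, x < y → (c x y = some a ↔ w a y < w a x)) ∧
      ∀ a x y, x ≠ y → (w a x < w a y ↔ (x < y ↔ c x y ≠ some a)) := by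
  obtain ⟨c, hc, hsome, hnone, hrev⟩ := exists_coloring (w := longest N) (by rwa [invA_longest])
  refine ⟨c, hc, hrev hw, ?_, hsome, fun a x y hxy =>
    lt_iff_color hc (fun x y h => hsome x y a h) hxy⟩
  have key : ∀ x y, x < y → c x y ≠ none := fun x y h h' => by
    have := (hnone x y h).1 h'
    rw [longest_apply, longest_apply, Fin.rev_lt_rev] at this
    exact h.asymm this
  intro x y hxy
  rcases lt_or_gt_of_ne hxy with h | h
  · exact key x y h
  · rw [hc.symm]
    exact key y x h

theorem lt_iff_of_color_eq {N m : ℕ} {C : Type*} {c : Fin N → Fin N → Option C} {a : C}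
    {w : Perm (Fin N)} (hlt : ∀ x y, x ≠ y → (w x < w y ↔ (x < y ↔ c x y ≠ some a)))
    {f : Fin N → Fin m} (hf : Monotone f)
    (h : ∀ x x' y, f x = f x' → f x ≠ f y → c x y = c x' y) (x x' y : Fin N)
    (h1 : f x = f x') (h2 : f x ≠ f y) : w x < w y ↔ w x' < w y := by
  have hl : ∀ x, f x ≠ f y → (x < y ↔ f x < f y) := fun x h => by
    rw [Monotone.lt_iff_and_ne hf]
    tauto
  rw [hlt x y (fun e => h2 (e ▸ rfl)), hlt x' y (fun e => h2 (e ▸ h1)), h x x' y h1 h2,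
    hl x h2, hl x' (h1 ▸ h2), h1]

theorem isDisjointUnion_comp {X : Type*} {r : ℕ} {S : Set X} {F : Fin r → Set X}
    (hD : IsDisjointUnion S F) (π : Perm (Fin r)) : IsDisjointUnion S fun a => F (π a) := by
  rw [isDisjointUnion_iff] at hD ⊢
  refine ⟨fun x => (hD.1 x).trans ⟨?_, ?_⟩, fun x a b ha hb => π.injective (hD.2 x _ _ ha hb)⟩
  · rintro ⟨a, ha⟩
    exact ⟨π.symm a, by rwa [Equiv.apply_symm_apply]⟩
  · rintro ⟨a, ha⟩
    exact ⟨π a, ha⟩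

/-- By symmetry the cut of a minus-decomposable member comes with its mirror image. The two cuts
bound three blocks, and every pair across them is inverted by that member alone, so it induces `w₀`
on the blocks and the other members induce the identity. -/
theorem exists_isInflationForm_of_minusDecomposable {n r : ℕ} (w : Fin r → WeylB n)
    (hD : IsDisjointUnion (posRootsA (2 * n + 1)) fun a => invA (tilde (w a))) (hr : 0 < r)
    (hmd : ∃ a, MinusDecomposable (tilde (w a))) :
    ∃ (π : Perm (Fin r)) (s q : ℕ) (σ : Fin r → WeylB s) (z : Fin (2 * s + 1) → ℕ)
      (β : Fin r → ∀ b, Perm (Fin (z b))), IsInflationForm hr (fun a => w (π a)) q σ z β := by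
  have hDπ := isDisjointUnion_comp hD
  obtain ⟨c, hc, hrev, hcol, hsome, hlt⟩ := exists_total_coloring (fun a => isSymm_tilde (w a)) hD
  obtain ⟨a₀, ha₀⟩ := hmd
  obtain ⟨p', hp', hpN', hcut'⟩ := minusDecomposable_iff.1 ha₀
  -- Of the cuts `p'` and `2n+1-p'`, exactly one is at most `n`; this choice leaves a nonempty
  -- middle block.
  obtain ⟨p, hp, hpn, hcut⟩ : ∃ p, 0 < p ∧ p ≤ n ∧ ∀ x y : Fin (2 * n + 1),
      (x : ℕ) < p ∧ p ≤ (y : ℕ) ∨ (x : ℕ) < 2 * n + 1 - p ∧ 2 * n + 1 - p ≤ (y : ℕ) →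
      tilde (w a₀) y < tilde (w a₀) x := by
    have hcut'' : ∀ x y : Fin (2 * n + 1), (x : ℕ) < 2 * n + 1 - p' → 2 * n + 1 - p' ≤ (y : ℕ) →
        tilde (w a₀) y < tilde (w a₀) x := by
      intro x y hx hy
      rw [← (isSymm_tilde (w a₀)).lt_iff]
      apply hcut' <;> rw [Fin.val_rev] <;> omega
    rcases le_or_gt p' n with h | h
    · refine ⟨p', hp', h, fun x y => ?_⟩
      rintro (⟨h1, h2⟩ | ⟨h1, h2⟩)
      · exact hcut' x y h1 h2
      · exact hcut'' x y h1 h2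
    · refine ⟨2 * n + 1 - p', by omega, by omega, fun x y => ?_⟩
      rintro (⟨h1, h2⟩ | ⟨h1, h2⟩)
      · exact hcut'' x y h1 h2
      · exact hcut' x y (by omega) (by omega)
  let f : Fin (2 * n + 1) → Fin (2 * 1 + 1) := fun x =>
    if (x : ℕ) < p then 0 else if (x : ℕ) < 2 * n + 1 - p then 1 else 2
  have hfv : ∀ x, (f x : ℕ) = if (x : ℕ) < p then 0 else if (x : ℕ) < 2 * n + 1 - p then 1 else 2 :=
    fun x => by simp only [f]; split_ifs <;> rfl
  have hf : Monotone f := by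
    intro x y hxy
    rw [Fin.le_def, hfv, hfv]
    have : (x : ℕ) ≤ y := hxy
    split_ifs <;> omega
  have hs : Surjective f := by
    intro b
    have hb := b.2
    obtain h | h | h : (b : ℕ) = 0 ∨ (b : ℕ) = 1 ∨ (b : ℕ) = 2 := by omega
    · refine ⟨⟨0, by omega⟩, Fin.ext ?_⟩
      rw [hfv, h]
      exact if_pos hp
    · refine ⟨⟨p, by omega⟩, Fin.ext ?_⟩
      rw [hfv, h]
      simp only
      split_ifs <;> omega
    · refine ⟨⟨2 * n, by omega⟩, Fin.ext ?_⟩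
      rw [hfv, h]
      simp only
      split_ifs <;> omega
  have hfr : ∀ x, f x.rev = (f x).rev := by
    intro x
    rw [Fin.ext_iff, Fin.val_rev, hfv, hfv, Fin.val_rev]
    have := x.2
    split_ifs <;> omega
  have hca : ∀ x y, f x ≠ f y → c x y = some a₀ := by
    have key : ∀ x y, f x < f y → c x y = some a₀ := by
      intro x y h
      rw [hsome x y a₀ (hf.reflect_lt h)]
      apply hcut
      rw [Fin.lt_def, hfv, hfv] at h
      have := x.2
      have := y.2
      split_ifs at h <;> omega
    intro x y h
    rcases lt_or_gt_of_ne h with h | h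
    · exact key x y h
    · rw [hc.symm]
      exact key y x h
  obtain ⟨π, hπ⟩ : ∃ π : Perm (Fin r), π ⟨0, hr⟩ = a₀ := ⟨swap ⟨0, hr⟩ a₀, swap_apply_left _ _⟩
  obtain ⟨σ, z, β, h1, h2, h3, h4⟩ := exists_inflation_family (fun a => w (π a)) hf hs hfr
    (fun a => lt_iff_of_color_eq (hlt (π a)) hf
      fun x x' y e1 e2 => by rw [hca x y e2, hca x' y (e1 ▸ e2)]) (hDπ π)
  have hσ : ∀ a b b', b ≠ b' → (tilde (σ a) b < tilde (σ a) b' ↔ (b < b' ↔ a₀ ≠ π a)) := by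
    intro a b b' hb
    obtain ⟨x, rfl⟩ := hs b
    obtain ⟨y, rfl⟩ := hs b'
    rw [h4 a x y hb, hlt _ _ _ (ne_of_apply_ne f hb), hca x y hb, Monotone.lt_iff_and_ne hf,
      ne_eq, ne_eq, Option.some_inj]
    tauto
  refine ⟨π, 1, 2, σ, z, β, le_rfl, h1, h2, h3, ?_, fun _ => ⟨?_, rfl⟩, fun h => ?_⟩
  · intro a ha
    apply tilde_injective
    rw [map_one]
    apply perm_ext_of_lt
    intro b b' hlt'
    have hb : b ≠ b' := by rintro rfl; exact lt_irrefl _ hlt'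
    have hne : a₀ ≠ π a := by
      intro e
      rw [← hπ] at e
      have := π.injective e
      rw [← this] at ha
      simp at ha
    exact ((hσ a b b' hb).1 hlt').2 hne
  · apply perm_ext_of_lt
    intro b b' hlt'
    have hb : b ≠ b' := by rintro rfl; exact lt_irrefl _ hlt'
    rw [hσ _ _ _ hb, hπ] at hlt'
    rw [longest_apply, longest_apply, Fin.rev_lt_rev]
    refine lt_of_le_of_ne (not_lt.1 fun h => ?_) hb.symm
    exact hlt'.1 h rfl
  · rw [hπ] at h
    exact absurd ha₀ h
-- A monochromatic cut would make the member of its colour minus-decomposable, so the prime quotient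
-- is available. Its two colours are moved to the first two positions; the remaining members invert
-- no pair across blocks.
theorem exists_isInflationForm_of_not_minusDecomposable {n r : ℕ} (hn : 1 ≤ n)
    (w : Fin r → WeylB n)
    (hD : IsDisjointUnion (posRootsA (2 * n + 1)) fun a => invA (tilde (w a))) (hr : 0 < r)
    (hmd : ¬ ∃ a, MinusDecomposable (tilde (w a))) :
    ∃ (π : Perm (Fin r)) (s q : ℕ) (σ : Fin r → WeylB s) (z : Fin (2 * s + 1) → ℕ)
      (β : Fin r → ∀ b, Perm (Fin (z b))), IsInflationForm hr (fun a => w (π a)) q σ z β := by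
  have hDπ := isDisjointUnion_comp hD
  obtain ⟨c, hc, hrev, hcol, hsome, hlt⟩ := exists_total_coloring (fun a => isSymm_tilde (w a)) hD
  have hcut : ¬ HasMonochromaticCut c := by
    rintro ⟨p, hp, hpN, d, hd⟩
    obtain ⟨a, rfl⟩ : ∃ a, d = some a := by
      rw [← Option.ne_none_iff_exists', ← hd ⟨0, by omega⟩ ⟨2 * n, by omega⟩ hp (by simp; omega)]
      apply hcol
      rw [Ne, Fin.mk.injEq]
      omega
    refine hmd ⟨a, minusDecomposable_iff.2 ⟨p, hp, hpN, fun x y hx hy => ?_⟩⟩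
    rw [← hsome x y a (by rw [Fin.lt_def]; omega), hd x y hx hy]
  obtain ⟨s, f, hs2, hf, hs, hfr, hhom, htriv, d₁, d₂, hd, htwo, ⟨x₁, y₁, hl₁, -, hx₁⟩,
    x₂, y₂, hl₂, -, hx₂⟩ := exists_prime_quotient hn hc hrev hcut
  obtain ⟨a₁, rfl⟩ := Option.ne_none_iff_exists'.1 (hx₁ ▸ hcol x₁ y₁ hl₁.ne)
  obtain ⟨a₂, rfl⟩ := Option.ne_none_iff_exists'.1 (hx₂ ▸ hcol x₂ y₂ hl₂.ne)
  have ha : a₁ ≠ a₂ := fun e => hd (e ▸ rfl)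
  have hr1 : 1 < r := by
    by_contra h
    have h1 := a₁.2
    have h2 := a₂.2
    exact ha (Fin.ext (by omega))
  obtain ⟨π, hπ₁, hπ₂⟩ := exists_perm_pair (i := (⟨0, hr⟩ : Fin r)) (j := ⟨1, hr1⟩)
    (by simp) ha
  obtain ⟨σ, z, β, h1, h2, h3, h4⟩ := exists_inflation_family (fun a => w (π a)) hf hs hfr
    (fun a => lt_iff_of_color_eq (hlt (π a)) hf hhom) (hDπ π)
  have hσ : ∀ a x y, f x ≠ f y →
      (tilde (σ a) (f x) < tilde (σ a) (f y) ↔ (f x < f y ↔ c x y ≠ some (π a))) := by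
    intro a x y hb
    rw [h4 a x y hb, hlt _ _ _ (ne_of_apply_ne f hb), Monotone.lt_iff_and_ne hf]
    tauto
  refine ⟨π, s, 3, σ, z, β, by omega, h1, h2, h3, ?_, fun h => ?_, fun _ => ⟨hs2, ?_, ⟨hr1, ?_⟩,
    rfl⟩⟩
  · intro a ha
    apply tilde_injective
    rw [map_one]
    apply perm_ext_of_lt
    intro b b' hlt'
    have hb : b ≠ b' := by rintro rfl; exact lt_irrefl _ hlt'
    obtain ⟨x, rfl⟩ := hs b
    obtain ⟨y, rfl⟩ := hs b'
    refine ((hσ a x y hb).1 hlt').2 fun e => ?_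
    rcases htwo x y hb with h | h
    · rw [e, Option.some_inj, ← hπ₁] at h
      rw [π.injective h] at ha
      simp at ha
    · rw [e, Option.some_inj, ← hπ₂] at h
      rw [π.injective h] at ha
      simp at ha
  · exact absurd ⟨_, h⟩ hmd
  · rw [isSimpleB_iff]
    intro R hR hRs hRc
    refine htriv R hR fun x x' y e1 e2 => ?_
    have hxy : f x ≠ f y := fun e => e2 (e ▸ hR.equiv.refl _)
    have hxy' : f x' ≠ f y := fun e => e2 (e ▸ e1)
    have k1 := hRc _ _ _ e1 e2
    rw [hσ _ _ _ hxy, hσ _ _ _ hxy', hπ₁, hR.lt_iff e1 e2] at k1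
    -- With only two colours between blocks, knowing whether a pair has colour `a₁` determines its
    -- colour, so a relation compatible with `σ_1` is homogeneous.
    rcases htwo x y hxy with h | h <;> rcases htwo x' y hxy' with h' | h'
    · rw [h, h']
    · rw [h, h'] at k1
      simp only [ne_eq, not_true, Option.some_inj, ha.symm, not_false_iff] at k1
      tauto
    · rw [h, h'] at k1
      simp only [ne_eq, not_true, Option.some_inj, ha.symm, not_false_iff] at k1
      tauto
    · rw [h, h']
  · apply perm_ext_of_lt
    intro b b' hlt'
    have hb : b ≠ b' := by rintro rfl; exact lt_irrefl _ hlt'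
    obtain ⟨x, rfl⟩ := hs b
    obtain ⟨y, rfl⟩ := hs b'
    rw [hσ _ _ _ hb, hπ₂] at hlt'
    rw [Perm.mul_apply, Perm.mul_apply, longest_apply, longest_apply, Fin.rev_lt_rev,
      lt_iff_not_lt _ hb.symm, hσ _ _ _ hb, hπ₁]
    rcases htwo x y hb with h | h <;> rw [h] at hlt' ⊢ <;>
      simpa only [ne_eq, not_true, Option.some_inj, ha, ha.symm, not_false_iff, iff_true,
        iff_false, not_not] using hlt'

theorem exists_isInflationForm {n r : ℕ} (hn : 1 ≤ n) (w : Fin r → WeylB n)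
    (hD : IsDisjointUnion (posRootsA (2 * n + 1)) fun a => invA (tilde (w a))) (hr : 0 < r) :
    ∃ (π : Perm (Fin r)) (s q : ℕ) (σ : Fin r → WeylB s) (z : Fin (2 * s + 1) → ℕ)
      (β : Fin r → ∀ b, Perm (Fin (z b))), IsInflationForm hr (fun a => w (π a)) q σ z β := by
  by_cases hmd : ∃ a, MinusDecomposable (tilde (w a))
  · exact exists_isInflationForm_of_minusDecomposable w hD hr hmd
  · exact exists_isInflationForm_of_not_minusDecomposable hn w hD hr hmd

/-! ### Symmetric families -/

section families

variable {N m : ℕ} {z : Fin m → ℕ} {h : ∑ b, z b = N} {w : Perm (Fin N)} {σ : Perm (Fin m)}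
  {β : ∀ b, Perm (Fin (z b))}

theorem exists_symm_isInfl (hσ : IsSymm σ) (hβ : IsSymmetricFamily z β) :
    ∃ w, IsInfl z h w σ β ∧ IsSymm w :=
  ⟨_, isInfl_inflate σ β, (isInfl_inflate (h := h) σ β).isSymm hβ hσ⟩

theorem conj_longest_one {N M : ℕ} (e : N = M) :
    (finCongr e).permCongr (longest N * 1 * longest N) = 1 := by
  subst e
  ext i
  simp [longest_apply]

theorem isSymmetricFamily_one (hz : ∀ b, z b = z b.rev) :
    IsSymmetricFamily z (fun b => (1 : Perm (Fin (z b)))) :=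
  ⟨hz, fun b => (conj_longest_one (hz b)).symm⟩

theorem isSymmetricFamily_ite (hβ : IsSymmetricFamily z β) (P : Fin m → Prop) [DecidablePred P]
    (hP : ∀ b, P b.rev ↔ P b) : IsSymmetricFamily z (fun b => if P b then β b else 1) := by
  obtain ⟨hz, hβ⟩ := hβ
  refine ⟨hz, fun b => ?_⟩
  beta_reduce
  by_cases hb : P b
  · rw [if_pos hb, if_pos ((hP b).2 hb), hβ]
  · rw [if_neg hb, if_neg fun h => hb ((hP b).1 h), conj_longest_one]

theorem isSymmetricFamily_rev_eq_one_iff (hβ : IsSymmetricFamily z β) (b : Fin m) :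
    β b.rev = 1 ↔ β b = 1 := by
  have key : ∀ b, β b = 1 → β b.rev = 1 := by
    intro b hb
    obtain ⟨hz, hβ⟩ := hβ
    rw [hβ, hb, conj_longest_one]
  refine ⟨fun hb => ?_, key b⟩
  have := key _ hb
  rwa [Fin.rev_rev] at this

/-- Irreducibility of a member of a symmetric family: symmetric decompositions are considered for
the middle block, all decompositions for the others. -/
def BlockIrreducible (b : Fin m) (δ : Perm (Fin (z b))) : Prop :=
  ∀ (k : ℕ) (γ : Fin (k + 1) → Perm (Fin (z b))), (b.rev = b → ∀ a, IsSymm (γ a)) →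
    IsDisjointUnion (invA δ) (fun a => invA (γ a)) → ∃ a, γ a = δ

theorem blockIrreducible_iff_irreducibleA {b : Fin m} (hb : b.rev ≠ b) {δ : Perm (Fin (z b))} :
    BlockIrreducible b δ ↔ IrreducibleA δ := by
  rw [irreducibleA_iff]
  exact ⟨fun h k γ hD => h k γ (fun e => absurd e hb) hD, fun h k γ _ hD => h k γ hD⟩

theorem blockIrreducible_iff_symmIrreducible {b : Fin m} (hb : b.rev = b) {δ : Perm (Fin (z b))} :
    BlockIrreducible b δ ↔ SymmIrreducible δ :=
  ⟨fun h k γ hγ hD => h k γ (fun _ => hγ) hD, fun h k γ hγ hD => h k γ (hγ hb) hD⟩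

theorem blockIrreducible_one (b : Fin m) : BlockIrreducible b (1 : Perm (Fin (z b))) :=
  fun k γ _ hD => irreducibleA_iff.1 irreducibleA_one k γ hD

/-- The symmetric family with member `γ` at `b` and trivial away from `b` and its mirror image. -/
def symmExtend (hz : ∀ b, z b = z b.rev) (b : Fin m) (γ : Perm (Fin (z b))) (x : Fin m) :
    Perm (Fin (z x)) :=
  if h : x = b then (finCongr (congrArg z h.symm)).permCongr γ
  else if h : x.rev = b then
    (finCongr ((congrArg z h.symm).trans (hz x).symm)).permCongr (longest _ * γ * longest _)
  else 1

theorem symmExtend_self (hz : ∀ b, z b = z b.rev) (b : Fin m) (γ : Perm (Fin (z b))) :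
    symmExtend hz b γ b = γ := by
  rw [symmExtend, dif_pos rfl]
  rfl

theorem permCongr_conj_conj {A B D : ℕ} (e₁ : A = B) (e₂ : B = D) (e₃ : A = D)
    (γ : Perm (Fin A)) :
    (finCongr e₂).permCongr
      (longest B * (finCongr e₁).permCongr (longest A * γ * longest A) * longest B) =
        (finCongr e₃).permCongr γ := by
  subst e₁ e₂
  ext i
  simp [longest_apply]

theorem conj_longest_of_isSymm {N : ℕ} {γ : Perm (Fin N)} (hγ : IsSymm γ) :
    longest N * γ * longest N = γ := by
  ext i
  simp [longest_apply, hγ i]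

/-- The mirror block carries the conjugate by the longest element. The middle block is its own
mirror, which is why `γ` must be symmetric there. -/
theorem isSymmetricFamily_symmExtend (hz : ∀ b, z b = z b.rev) (b : Fin m) (γ : Perm (Fin (z b)))
    (hγ : b.rev = b → IsSymm γ) : IsSymmetricFamily z (symmExtend hz b γ) := by
  refine ⟨hz, fun x => ?_⟩
  by_cases h1 : x = b
  · subst h1
    rw [symmExtend_self]
    by_cases h2 : x.rev = x
    · rw [symmExtend, dif_pos h2, conj_longest_of_isSymm (hγ h2)]
    · rw [symmExtend, dif_neg h2, dif_pos (Fin.rev_rev x)]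
  · by_cases h2 : x.rev = b
    · rw [symmExtend, dif_pos h2, symmExtend, dif_neg h1, dif_pos h2, permCongr_conj_conj]
    · rw [symmExtend, dif_neg h2, dif_neg (by rwa [Fin.rev_rev]), symmExtend, dif_neg h1,
        dif_neg h2, conj_longest_one]

theorem eq_symmExtend (hβ : IsSymmetricFamily z β) (b : Fin m)
    (hoff : ∀ x, x ≠ b → x.rev ≠ b → β x = 1) (x : Fin m) :
    β x = symmExtend hβ.1 b (β b) x := by
  by_cases h1 : x = b
  · subst h1
    rw [symmExtend_self]
  · by_cases h2 : x.rev = b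
    · subst h2
      rw [symmExtend, dif_neg h1, dif_pos rfl, hβ.2 x, permCongr_conj_conj _ _ rfl]
      rfl
    · rw [symmExtend, dif_neg h1, dif_neg h2, hoff x h1 h2]

theorem mem_invA_permCongr {A B : ℕ} (e : A = B) (γ : Perm (Fin A)) (i j : Fin B) :
    (i, j) ∈ invA ((finCongr e).permCongr γ) ↔
      ((finCongr e).symm i, (finCongr e).symm j) ∈ invA γ := by
  subst e
  rfl

theorem mem_invA_conj {A : ℕ} (γ : Perm (Fin A)) (i j : Fin A) :
    (i, j) ∈ invA (longest A * γ * longest A) ↔ (j.rev, i.rev) ∈ invA γ := by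
  simp [mem_invA, longest_apply]

theorem isDisjointUnion_symmExtend (hz : ∀ b, z b = z b.rev) (b : Fin m) {r : ℕ}
    {δ : Perm (Fin (z b))} {γ : Fin r → Perm (Fin (z b))}
    (hD : IsDisjointUnion (invA δ) fun a => invA (γ a)) (x : Fin m) :
    IsDisjointUnion (invA (symmExtend hz b δ x)) fun a => invA (symmExtend hz b (γ a) x) := by
  unfold symmExtend
  split_ifs with h1 h2
  · rw [isDisjointUnion_iff] at hD ⊢
    simp only [Prod.forall, mem_invA_permCongr]
    exact ⟨fun i j => hD.1 _, fun i j a a' => hD.2 _ _ _⟩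
  · rw [isDisjointUnion_iff] at hD ⊢
    simp only [Prod.forall, mem_invA_permCongr, mem_invA_conj]
    exact ⟨fun i j => hD.1 _, fun i j a a' => hD.2 _ _ _⟩
  · exact isDisjointUnion_one

/-! ### Consequences of irreducibility -/

/-- The inversions of `σ[β]` across blocks and inside blocks form the inversion sets of `σ[1]` and
`1[β]`, both symmetric, so one of these is trivial. -/
theorem SymmIrreducible.perm_eq_one_or (hw : SymmIrreducible w) (hi : IsInfl z h w σ β)
    (hz : ∀ b, 0 < z b) (hσ : IsSymm σ) (hβ : IsSymmetricFamily z β) : σ = 1 ∨ ∀ b, β b = 1 := by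
  obtain ⟨u, hu, hus⟩ := exists_symm_isInfl (h := h) hσ (isSymmetricFamily_one hβ.1)
  obtain ⟨v, hv, hvs⟩ := exists_symm_isInfl (h := h) isSymm_one hβ
  have hD : IsDisjointUnion (invA w) fun a => invA (![u, v] a) :=
    hi.isDisjointUnion (S := ![σ, 1]) (B := ![fun _ => 1, β])
      (Fin.forall_fin_two.2 ⟨hu, hv⟩) (isDisjointUnion_self_one σ) fun b => by
        convert isDisjointUnion_one_self (β b) using 2 with k
        fin_cases k <;> rfl
  rcases hw.eq_one_or_eq_one hus hvs hD with rfl | rfl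
  · exact Or.inl (hu.perm_eq_of_eq hz isInfl_one)
  · exact Or.inr fun b => hv.family_eq_of_eq isInfl_one b

/-- The family is split into its part on `b` and the mirror of `b`, and the rest; both parts are
symmetric. -/
theorem SymmIrreducible.family_eq_one_or (hw : SymmIrreducible w) (hi : IsInfl z h w 1 β)
    (hβ : IsSymmetricFamily z β) (b : Fin m) :
    β b = 1 ∨ ∀ x, x ≠ b → x.rev ≠ b → β x = 1 := by
  classical
  let P : Fin m → Prop := fun x => x = b ∨ x.rev = b
  have hP : ∀ x, P x.rev ↔ P x := fun x => by
    simp only [P, Fin.rev_rev]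
    tauto
  obtain ⟨u, hu, hus⟩ := exists_symm_isInfl (h := h) isSymm_one (isSymmetricFamily_ite hβ P hP)
  obtain ⟨v, hv, hvs⟩ := exists_symm_isInfl (h := h) isSymm_one
    (isSymmetricFamily_ite hβ (fun x => ¬ P x) fun x => not_congr (hP x))
  have hD : IsDisjointUnion (invA w) fun a => invA (![u, v] a) :=
    hi.isDisjointUnion (S := ![1, 1])
      (B := ![fun x => if P x then β x else 1, fun x => if ¬ P x then β x else 1])
      (Fin.forall_fin_two.2 ⟨hu, hv⟩) (isDisjointUnion_self_one 1) fun x => by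
        by_cases hx : P x
        · convert isDisjointUnion_self_one (β x) using 2 with k
          fin_cases k <;> simp [hx]
        · convert isDisjointUnion_one_self (β x) using 2 with k
          fin_cases k <;> simp [hx]
  rcases hw.eq_one_or_eq_one hus hvs hD with rfl | rfl
  · left
    have : (if P b then β b else 1) = 1 := hu.family_eq_of_eq isInfl_one b
    rwa [if_pos (Or.inl rfl)] at this
  · right
    intro x h1 h2
    have : (if ¬ P x then β x else 1) = 1 := hv.family_eq_of_eq isInfl_one x
    rwa [if_pos (by simp [P, h1, h2])] at this

/-- If `β b` is nontrivial, the family lives on `b` and its mirror, so a decomposition of `β b`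
extends symmetrically to one of `w`. -/
theorem SymmIrreducible.blockIrreducible (hw : SymmIrreducible w) (hi : IsInfl z h w 1 β)
    (hβ : IsSymmetricFamily z β) (b : Fin m) : BlockIrreducible b (β b) := by
  rcases hw.family_eq_one_or hi hβ b with hb | hoff
  · rw [hb]
    exact blockIrreducible_one b
  · intro k γ hγ hD
    choose W hW hWs using fun a => exists_symm_isInfl (h := h) isSymm_one
      (isSymmetricFamily_symmExtend hβ.1 b (γ a) fun e => hγ e a)
    obtain ⟨a, rfl⟩ := hw k W hWs (hi.isDisjointUnion (S := fun _ => 1) hW isDisjointUnion_one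
      fun x => by
        rw [eq_symmExtend hβ b hoff x]
        exact isDisjointUnion_symmExtend hβ.1 b hD x)
    refine ⟨a, ?_⟩
    rw [← (hW a).family_eq_of_eq hi b, symmExtend_self]

/-! ### Sufficient conditions for irreducibility -/

theorem blockEmb_of_eq {b b' : Fin m} (e : b' = b) (j : Fin (z b')) :
    blockEmb z h b' j = blockEmb z h b (finCongr (congrArg z e) j) := by
  subst e
  rfl

theorem blockEmb_rev_of_eq (hz : ∀ b, z b = z b.rev) {b : Fin m} (e : b.rev = b) (i : Fin (z b)) :
    blockEmb z h b i.rev = (blockEmb z h b i).rev := by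
  rw [← blockEmb_rev hz, blockEmb_of_eq e]
  rfl

/-- Restrict a decomposition of `w` to block `b`: one member takes all inversions there. By symmetry
it takes those in the mirror block, and `w` has no others. -/
theorem symmIrreducible_of_blockIrreducible (hi : IsInfl z h w 1 β) (hw : IsSymm w)
    (hz : ∀ b, z b = z b.rev) {b : Fin m} (hoff : ∀ x, x ≠ b → x.rev ≠ b → β x = 1)
    (hb : BlockIrreducible b (β b)) : SymmIrreducible w := by
  intro k γ hγ hD
  have hD' := isDisjointUnion_iff.1 hD
  choose τ hτ using fun a => exists_perm_lt (fun i => γ a (blockEmb z h b i))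
    ((γ a).injective.comp (blockEmb_injective b))
  have hmem : ∀ a i j, (i, j) ∈ invA (τ a) ↔ (blockEmb z h b i, blockEmb z h b j) ∈ invA (γ a) :=
    fun a i j => by rw [mem_invA, mem_invA, hτ, blockEmb_lt_iff]
  obtain ⟨a, ha⟩ := hb k τ (fun e a => isSymm_of_lt fun i j hij => by
      rw [hτ] at hij ⊢
      rwa [blockEmb_rev_of_eq hz e, blockEmb_rev_of_eq hz e, (hγ a).lt_iff]) (by
    rw [isDisjointUnion_iff]
    constructor
    · rintro ⟨i, j⟩
      simp only [hmem, ← hi.mem_same, hD'.1]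
    · rintro ⟨i, j⟩ a a'
      simp only [hmem]
      exact hD'.2 _ _ _)
  have key : ∀ i j, (blockEmb z h b i, blockEmb z h b j) ∈ invA w →
      (blockEmb z h b i, blockEmb z h b j) ∈ invA (γ a) := by
    intro i j hm
    rwa [← hmem, ha, ← hi.mem_same]
  refine ⟨a, invA_injective (Set.Subset.antisymm (fun p hp => (hD'.1 p).2 ⟨a, hp⟩) ?_)⟩
  rintro ⟨x, y⟩ hm
  obtain ⟨b₁, i, rfl⟩ := exists_blockEmb z h x
  obtain ⟨b₂, j, rfl⟩ := exists_blockEmb z h y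
  by_cases h12 : b₁ = b₂
  · subst h12
    by_cases h1 : b₁ = b
    · subst h1
      exact key i j hm
    · by_cases h2 : b₁.rev = b
      · subst h2
        rw [← hw.mem_invA, ← blockEmb_rev hz, ← blockEmb_rev hz] at hm
        have := key _ _ hm
        rwa [blockEmb_rev hz, blockEmb_rev hz, (hγ a).mem_invA] at this
      · rw [hi.mem_same, hoff _ h1 h2, invA_one] at hm
        exact absurd hm (Set.notMem_empty _)
  · rw [hi.mem_ne h12, invA_one] at hm
    exact absurd hm (Set.notMem_empty _)

theorem eq_one_of_isDisjointUnion_one {N r : ℕ} {γ : Fin r → Perm (Fin N)}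
    (hD : IsDisjointUnion (invA (1 : Perm (Fin N))) fun a => invA (γ a)) (a : Fin r) :
    γ a = 1 := by
  apply invA_injective
  rw [invA_one, Set.eq_empty_iff_forall_notMem]
  intro x hx
  have := ((isDisjointUnion_iff.1 hD).1 x).2 ⟨a, hx⟩
  rwa [invA_one] at this

/-- Inflating by increasing blocks preserves irreducibility. -/
theorem SymmIrreducible.inflate (hσ : SymmIrreducible σ) (hi : IsInfl z h w σ fun _ => 1)
    (hz0 : ∀ b, 0 < z b) (hz : ∀ b, z b = z b.rev) : SymmIrreducible w := by
  intro k γ hγ hD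
  obtain ⟨c, hc, hsome, hnone, -⟩ := exists_coloring hD
  have hnone' : ∀ b b' i i' j j', b ≠ b' → c (blockEmb z h b i) (blockEmb z h b' j) = none →
      c (blockEmb z h b i') (blockEmb z h b' j') = none := by
    have key : ∀ b b' i i' j j', b < b' → c (blockEmb z h b i) (blockEmb z h b' j) = none →
        c (blockEmb z h b i') (blockEmb z h b' j') = none := by
      intro b b' i i' j j' hlt
      rw [hnone _ _ (blockEmb_lt_of_lt hlt _ _), hnone _ _ (blockEmb_lt_of_lt hlt _ _),
        hi.ne _ _ _ _ hlt.ne, hi.ne _ _ _ _ hlt.ne]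
      exact id
    intro b b' i i' j j' hb
    rcases lt_or_gt_of_ne hb with hlt | hlt
    · exact key _ _ _ _ _ _ hlt
    · rw [hc.symm (blockEmb z h b i), hc.symm (blockEmb z h b i')]
      exact key _ _ _ _ _ _ hlt
  have hin : ∀ b i i', i ≠ i' → c (blockEmb z h b i) (blockEmb z h b i') = none := by
    have key : ∀ b i i', i < i' → c (blockEmb z h b i) (blockEmb z h b i') = none := by
      intro b i i' hlt
      rw [hnone _ _ ((blockEmb_lt_iff i i').2 hlt), hi.same]
      exact hlt
    intro b i i' hne
    rcases lt_or_gt_of_ne hne with hlt | hlt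
    · exact key _ _ _ hlt
    · rw [hc.symm]
      exact key _ _ _ hlt
  -- The side inside the block is uncoloured. If another side of the triangle is uncoloured too,
  -- then `σ` does not invert the two blocks and all pairs across them are uncoloured; otherwise the
  -- no-rainbow rule equates the two sides to `j`.
  have hstep : ∀ b b' i i' j, b ≠ b' →
      c (blockEmb z h b i) (blockEmb z h b' j) = c (blockEmb z h b i') (blockEmb z h b' j) := by
    intro b b' i i' j hb
    by_cases hii : i = i'
    · rw [hii]
    · have h0 := hin b i i' hii
      rcases hc.no_rainbow _ _ _ (fun e => hii (blockEmb_injective b e))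
        (blockEmb_ne (h := h) hb i' j) (blockEmb_ne hb i j) with e | e | e
      · rw [h0] at e
        rw [← e, hnone' b b' i' i j j hb e.symm]
      · rw [h0] at e
        rw [e, hnone' b b' i i' j j hb e]
      · exact e
  have hcol : ∀ b b' i i' j j', b ≠ b' →
      c (blockEmb z h b i) (blockEmb z h b' j) = c (blockEmb z h b i') (blockEmb z h b' j') := by
    intro b b' i i' j j' hb
    rw [hstep b b' i i' j hb, hc.symm, hstep b' b j j' i' hb.symm, hc.symm]
  choose S B hSB using fun a => exists_isInfl (h := h) hz0 (γ a) fun b b' i i' j j' hb hlt => by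
    rw [lt_iff_color hc (fun x y h => hsome x y a h) (blockEmb_ne hb _ _),
      blockEmb_lt_iff_of_ne hb] at hlt ⊢
    rwa [hcol b b' i' i j' j hb]
  have hB : ∀ a b, B a b = 1 := fun a b =>
    eq_one_of_isDisjointUnion_one (hi.isDisjointUnion_family hSB hD b) a
  obtain ⟨a, ha⟩ := hσ k S (fun a => (hSB a).isSymm_perm hz hz0 (hγ a))
    (hi.isDisjointUnion_perm hz0 hSB hD)
  refine ⟨a, IsInfl.ext (hSB a) ?_⟩
  rw [ha, funext (hB a)]
  exact hi

end families

/-! ### Irreducibility of the longest element and of simple elements -/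

/-- Multiplying by `w₀` on the left reverses all comparisons of values, so the two inversion sets
are complementary. -/
theorem isDisjointUnion_longest_mul {N : ℕ} (v : Perm (Fin N)) :
    IsDisjointUnion (invA (longest N)) fun a => invA (![v, longest N * v] a) := by
  have key : ∀ x y : Fin N, (x, y) ∈ invA (longest N * v) ↔ x < y ∧ v x < v y := fun x y => by
    rw [mem_invA, Perm.mul_apply, Perm.mul_apply, longest_apply, longest_apply, Fin.rev_lt_rev]
  rw [isDisjointUnion_iff]
  constructor
  · rintro ⟨x, y⟩
    simp only [Fin.exists_fin_two, Matrix.cons_val_zero, Matrix.cons_val_one]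
    rw [key, invA_longest, mem_posRootsA, mem_invA, ← and_or_left]
    refine (and_iff_left_of_imp fun h => ?_).symm
    rw [lt_iff_not_lt v h.ne]
    exact em _
  · rintro ⟨x, y⟩ a b ha hb
    fin_cases a <;> fin_cases b
    · rfl
    · exact absurd ha.2 ((key x y).1 hb).2.asymm
    · exact absurd hb.2 ((key x y).1 ha).2.asymm
    · rfl

theorem longest_ne_one {s : ℕ} (hs : 1 ≤ s) : longest (2 * s + 1) ≠ 1 := by
  intro e
  have := congrArg Fin.val (Perm.congr_fun e 0)
  simp [longest_apply] at this
  omega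

theorem isSymm_swap_ends (s : ℕ) : IsSymm (swap (0 : Fin (2 * s + 1)) (Fin.last (2 * s))) := by
  intro x
  by_cases h0 : x = 0
  · rw [h0, Fin.rev_zero, swap_apply_left, swap_apply_right, Fin.rev_last]
  · by_cases h1 : x = Fin.last (2 * s)
    · rw [h1, Fin.rev_last, swap_apply_left, swap_apply_right, Fin.rev_zero]
    · rw [swap_apply_of_ne_of_ne h0 h1, swap_apply_of_ne_of_ne]
      · rwa [Ne, Fin.rev_eq_iff, Fin.rev_zero]
      · rwa [Ne, Fin.rev_eq_iff, Fin.rev_last]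

/-- Exchanging the two end blocks is a symmetric permutation `v`, and `w₀` splits into `v` and
`w₀v`. For `s ≥ 2` the second is nontrivial, since it moves the second letter; for `s = 1` it is the
identity. -/
theorem SymmIrreducible.eq_one_of_longest {N s : ℕ} {z : Fin (2 * s + 1) → ℕ}
    {h : ∑ b, z b = N} {w : Perm (Fin N)} (hs : 1 ≤ s) (hw : SymmIrreducible w)
    (hi : IsInfl z h w (longest (2 * s + 1)) fun _ => 1) (hz0 : ∀ b, 0 < z b)
    (hz : ∀ b, z b = z b.rev) : s = 1 := by
  by_contra hne
  let v := swap (0 : Fin (2 * s + 1)) (Fin.last (2 * s))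
  have hv : IsSymm v := isSymm_swap_ends s
  obtain ⟨u₁, hu₁, hs₁⟩ := exists_symm_isInfl (h := h) hv (isSymmetricFamily_one hz)
  obtain ⟨u₂, hu₂, hs₂⟩ := exists_symm_isInfl (h := h) (isSymm_longest.mul hv)
    (isSymmetricFamily_one hz)
  have hD : IsDisjointUnion (invA w) fun a => invA (![u₁, u₂] a) :=
    hi.isDisjointUnion (S := ![v, longest _ * v]) (B := fun _ _ => 1)
      (Fin.forall_fin_two.2 ⟨hu₁, hu₂⟩) (isDisjointUnion_longest_mul v)
      fun b => isDisjointUnion_one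
  rcases hw.eq_one_or_eq_one hs₁ hs₂ hD with rfl | rfl
  · have := congrArg Fin.val (Perm.congr_fun (hu₁.perm_eq_of_eq hz0 isInfl_one) 0)
    simp only [v, swap_apply_left] at this
    simp at this
    omega
  · have := Perm.congr_fun (hu₂.perm_eq_of_eq hz0 isInfl_one) ⟨1, by omega⟩
    rw [Perm.mul_apply, swap_apply_of_ne_of_ne, longest_apply] at this
    · have := congrArg Fin.val this
      simp [Fin.val_rev] at this
      omega
    · simp [Fin.ext_iff]
    · rw [Ne, Fin.ext_iff, Fin.val_last]
      simp only
      omega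

/-- The only symmetric permutations of three letters are the identity and the reversal, so a
nontrivial member must be everything. -/
theorem symmIrreducible_longest_three : SymmIrreducible (longest (2 * 1 + 1)) := by
  intro k γ hγ hD
  have key : ∀ τ : Perm (Fin 3), (∀ x, τ x.rev = (τ x).rev) → τ = 1 ∨ τ = Fin.revPerm := by decide
  have hm : ((0 : Fin 3), (1 : Fin 3)) ∈ invA (longest 3) := by
    rw [invA_longest, mem_posRootsA]
    decide
  obtain ⟨a, ha⟩ := ((isDisjointUnion_iff.1 hD).1 _).1 hm
  refine ⟨a, (key (γ a) (hγ a)).resolve_left fun e => ?_⟩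
  rw [e, invA_one] at ha
  exact ha

/-- A nontrivial decomposition uses at least two colours on the inversions, and `τ ≠ w₀` leaves an
uncoloured pair. Three values give a nontrivial symmetric homogeneous division, which is compatible
with `τ` because `τ` is determined by the uncoloured pairs. -/
theorem HasTrivialBlocks.symmIrreducible {N : ℕ} {τ : Perm (Fin N)} (hτ : HasTrivialBlocks τ)
    (hl : τ ≠ longest N) : SymmIrreducible τ := by
  intro k γ hγ hD
  by_contra! hcon
  have hD' := isDisjointUnion_iff.1 hD
  obtain ⟨c, hc, hsome, hnone, hrev⟩ := exists_coloring hD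
  have hsub : ∀ a, ∃ x y, x < y ∧ τ y < τ x ∧ c x y ≠ some a := by
    intro a
    by_contra! h
    refine hcon a (invA_injective (Set.Subset.antisymm (fun p hp => (hD'.1 p).2 ⟨a, hp⟩) ?_))
    rintro ⟨x, y⟩ hm
    exact ⟨hm.1, (hsome x y a hm.1).1 (h x y hm.1 hm.2)⟩
  have hget : ∀ x y, x < y → τ y < τ x → ∃ a, c x y = some a := by
    intro x y hxy hm
    rw [← Option.ne_none_iff_exists', Ne, hnone x y hxy]
    exact hm.asymm
  obtain ⟨x₁, y₁, h₁, hm₁, -⟩ := hsub 0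
  obtain ⟨a₁, ha₁⟩ := hget x₁ y₁ h₁ hm₁
  obtain ⟨x₂, y₂, h₂, hm₂, hne⟩ := hsub a₁
  obtain ⟨a₂, ha₂⟩ := hget x₂ y₂ h₂ hm₂
  obtain ⟨x₀, y₀, h₀, ha₀⟩ : ∃ x y, x < y ∧ c x y = none := by
    by_contra! h
    refine hl (perm_ext_of_lt fun x y hxy => ?_)
    rw [longest_apply, longest_apply, Fin.rev_lt_rev]
    have hne : x ≠ y := by rintro rfl; exact lt_irrefl _ hxy
    refine lt_of_le_of_ne (not_lt.1 fun hlt => h x y hlt ((hnone x y hlt).2 hxy)) hne.symm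
  rw [ha₂, Ne, Option.some_inj] at hne
  obtain ⟨R, hR, hRc, hRt, hRs⟩ := hc.exists_nontrivial ![none, some a₁, some a₂] (by
    intro i j hij
    fin_cases i <;> fin_cases j <;> simp [hne, Ne.symm hne] at hij ⊢) (by
    intro t
    fin_cases t
    exacts [⟨x₀, y₀, h₀.ne, ha₀⟩, ⟨x₁, y₁, h₁.ne, ha₁⟩, ⟨x₂, y₂, h₂.ne, ha₂⟩])
  refine hRt (hτ R hR (hRs (hrev hγ)) fun x x' y e1 e2 => ?_)
  have key : ∀ x y, x ≠ y → (τ x < τ y ↔ (x < y ↔ c x y = none)) := by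
    intro x y hxy
    rcases lt_or_gt_of_ne hxy with h | h
    · simp [h, hnone x y h]
    · rw [hc.symm x y, hnone y x h, lt_iff_not_lt _ hxy]
      simp [h.asymm]
  rw [key x y fun e => e2 (e ▸ hR.equiv.refl _), key x' y fun e => e2 (e ▸ e1),
    hRc _ _ _ e1 e2, hR.lt_iff e1 e2]

theorem HasTrivialBlocks.longest_mul {N : ℕ} {τ : Perm (Fin N)} (hτ : HasTrivialBlocks τ) :
    HasTrivialBlocks (longest N * τ) := by
  intro R hR hRs hRc
  refine hτ R hR hRs fun x x' y e1 e2 => ?_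
  have hxy : x ≠ y := fun e => e2 (e ▸ hR.equiv.refl _)
  have hxy' : x' ≠ y := fun e => e2 (e ▸ e1)
  have := hRc x x' y e1 e2
  simp only [Perm.mul_apply, longest_apply, Fin.rev_lt_rev] at this
  rw [lt_iff_not_lt _ hxy, lt_iff_not_lt _ hxy', this]

/-- Every interval division is compatible with the identity and with `w₀`. For `s ≥ 2`, grouping all
letters except the two ends is a nontrivial symmetric one. -/
theorem HasTrivialBlocks.ne_one_and_ne_longest {s : ℕ} (hs : 2 ≤ s)
    {τ : Perm (Fin (2 * s + 1))} (hτ : HasTrivialBlocks τ) :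
    τ ≠ 1 ∧ τ ≠ longest (2 * s + 1) := by
  let I : Fin (2 * s + 1) → Prop := fun x => 0 < (x : ℕ) ∧ (x : ℕ) < 2 * s
  let R : Fin (2 * s + 1) → Fin (2 * s + 1) → Prop := fun x y => x = y ∨ (I x ∧ I y)
  have hR : IsConvexEquiv R := by
    refine ⟨⟨fun x => Or.inl rfl, ?_, ?_⟩, ?_⟩
    · rintro x y (rfl | ⟨h1, h2⟩)
      · exact Or.inl rfl
      · exact Or.inr ⟨h2, h1⟩
    · rintro x y t (rfl | ⟨h1, h2⟩) (rfl | ⟨h3, h4⟩)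
      · exact Or.inl rfl
      · exact Or.inr ⟨h3, h4⟩
      · exact Or.inr ⟨h1, h2⟩
      · exact Or.inr ⟨h1, h4⟩
    · rintro x y t h1 h2 (rfl | ⟨h3, h4⟩)
      · exact Or.inl (le_antisymm h1 h2)
      · refine Or.inr ⟨h3, ?_⟩
        have : (x : ℕ) ≤ y := h1
        have : (y : ℕ) ≤ t := h2
        simp only [I] at *
        omega
  have hRs : IsSymmRel R := by
    rintro x y (rfl | ⟨h1, h2⟩)
    · exact Or.inl rfl
    · right
      simp only [I, Fin.val_rev] at *
      omega
  have hRt : ¬ IsTrivialRel R := by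
    rintro (hall | hinj)
    · rcases hall 0 ⟨1, by omega⟩ with h | ⟨h, -⟩
      · simp [Fin.ext_iff] at h
      · simp [I] at h
    · have := hinj ⟨1, by omega⟩ ⟨2, by omega⟩ (Or.inr ⟨⟨by simp, by simp only; omega⟩,
        ⟨by simp, by simp only; omega⟩⟩)
      simp at this
  constructor
  · rintro rfl
    exact hRt (hτ R hR hRs fun x x' y e1 e2 => hR.lt_iff e1 e2)
  · rintro rfl
    refine hRt (hτ R hR hRs fun x x' y e1 e2 => ?_)
    have hxy : x ≠ y := fun e => e2 (e ▸ hR.equiv.refl _)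
    have hxy' : x' ≠ y := fun e => e2 (e ▸ e1)
    have e : ∀ x y : Fin (2 * s + 1), x ≠ y →
        (longest (2 * s + 1) x < longest (2 * s + 1) y ↔ ¬ x < y) := fun x y h => by
      rw [longest_apply, longest_apply, Fin.rev_lt_rev, not_lt, le_iff_lt_or_eq]
      exact (or_iff_left h.symm).symm
    rw [e x y hxy, e x' y hxy', hR.lt_iff e1 e2]

/-! ### The irreducibility criterion -/

theorem rev_eq_self_iff {s : ℕ} (b : Fin (2 * s + 1)) : b.rev = b ↔ (b : ℕ) = s := by
  rw [Fin.ext_iff, Fin.val_rev]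
  omega

theorem le_or_rev_le {s : ℕ} (b : Fin (2 * s + 1)) : (b : ℕ) ≤ s ∨ (b.rev : ℕ) ≤ s := by
  rw [Fin.val_rev]
  omega

/-- The middle letter is fixed by the reversal, so it lies in the middle block and is a fixed point
of that block's reversal. -/
theorem odd_size_of_rev_eq {n m : ℕ} {z : Fin m → ℕ} {h : ∑ b, z b = 2 * n + 1}
    (hz : ∀ b, z b = z b.rev) {b : Fin m} (hb : b.rev = b) (hm : 2 * (b : ℕ) + 1 = m) :
    ∃ k, z b = 2 * k + 1 := by
  obtain ⟨b', i, hi⟩ := exists_blockEmb z h ⟨n, by omega⟩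
  have hx : (blockEmb z h b' i).rev = blockEmb z h b' i := by
    rw [← hi]
    ext
    rw [Fin.val_rev]
    simp only
    omega
  have hb' : b'.rev = b' := by
    by_contra hne
    rw [← blockEmb_rev hz] at hx
    exact blockEmb_ne hne _ _ hx
  obtain rfl : b' = b := by
    rw [Fin.ext_iff, Fin.val_rev] at hb'
    ext
    omega
  rw [← blockEmb_rev_of_eq hz hb'] at hx
  have := blockEmb_injective b' hx
  rw [Fin.ext_iff, Fin.val_rev] at this
  exact ⟨i, by omega⟩

section criterion

variable {n r s q : ℕ} {hr : 0 < r} {w : Fin r → WeylB n} {σ : Fin r → WeylB s}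
  {z : Fin (2 * s + 1) → ℕ} {β : Fin r → ∀ b, Perm (Fin (z b))}

theorem irreducibilityCriterion_of_irreducible {h : ∑ b, z b = 2 * n + 1}
    (hform : IsInflationForm hr w q σ z β)
    (hz0 : ∀ b, 0 < z b) (hi : ∀ a, IsInfl z h (tilde (w a)) (tilde (σ a)) (β a))
    (hne : ∀ a, tilde (w a) ≠ 1) (hw : ∀ a, SymmIrreducible (tilde (w a))) :
    IrreducibilityCriterion hr w q z β := by
  have hz := (hform.symmetric ⟨0, hr⟩).1
  have hone : ∀ a, tilde (σ a) ≠ 1 → ∀ b, β a b = 1 := fun a hσ =>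
    ((hw a).perm_eq_one_or (hi a) hz0 (isSymm_tilde _) (hform.symmetric a)).resolve_left hσ
  have hblock : ∀ a b, BlockIrreducible b (β a b) := by
    intro a b
    by_cases hσ : tilde (σ a) = 1
    · exact (hw a).blockIrreducible (hσ ▸ hi a) (hform.symmetric a) b
    · rw [hone a hσ]
      exact blockIrreducible_one b
  refine ⟨fun a b hb => ?_, fun a b hb => ?_, fun a ha => ?_, fun hmd => ?_, fun hmd => ?_⟩
  · exact (blockIrreducible_iff_irreducibleA (mt (rev_eq_self_iff b).1 hb)).1 (hblock a b)
  · have hb' := (rev_eq_self_iff b).2 hb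
    refine irreducibleSymmetric_iff.2 ⟨odd_size_of_rev_eq (h := h) hz hb' (by omega), fun i => ?_,
      (blockIrreducible_iff_symmIrreducible hb').1 (hblock a b)⟩
    have hs : IsSymm (β a b) := isSymm_of_lt fun i j hij => by
      rw [← (hi a).same] at hij ⊢
      rwa [blockEmb_rev_of_eq hz hb', blockEmb_rev_of_eq hz hb', (isSymm_tilde (w a)).lt_iff]
    exact hs i
  · have hi1 : IsInfl z h (tilde (w a)) 1 (β a) := by
      have := hi a
      rwa [hform.identity a ha, map_one] at this
    obtain ⟨b, hb⟩ : ∃ b, β a b ≠ 1 := by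
      by_contra! hall
      refine hne a (IsInfl.ext hi1 ?_)
      rw [funext hall]
      exact isInfl_one
    obtain ⟨b, hbs, hb⟩ : ∃ b : Fin (2 * s + 1), (b : ℕ) ≤ s ∧ β a b ≠ 1 := by
      rcases le_or_rev_le b with hbs | hbs
      · exact ⟨b, hbs, hb⟩
      · exact ⟨b.rev, hbs, fun e =>
          hb ((isSymmetricFamily_rev_eq_one_iff (hform.symmetric a) b).1 e)⟩
    refine ⟨b, ⟨hbs, hb⟩, ?_⟩
    rintro x ⟨hxs, hx⟩
    by_contra hxb
    refine hx (((hw a).family_eq_one_or hi1 (hform.symmetric a) b).resolve_left hb x hxb ?_)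
    -- Both `b` and `x` are in the first half; if they are mirror images, both are the middle block
    -- and so equal.
    intro e
    apply hxb
    rw [Fin.ext_iff, Fin.val_rev] at e
    ext
    omega
  · have hσ := (hform.minus_decomposable hmd).1
    have hβ := hone _ (hσ ▸ longest_ne_one hform.one_le)
    refine ⟨SymmIrreducible.eq_one_of_longest (h := h) hform.one_le (hw ⟨0, hr⟩) ?_ hz0 hz, hβ⟩
    have := hi ⟨0, hr⟩
    rwa [hσ, funext hβ] at this
  · obtain ⟨hs2, hsim, ⟨hr1, hσ⟩, -⟩ := hform.minus_indecomposable hmd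
    have ht := isSimpleB_iff.1 hsim
    intro a ha
    apply hone
    obtain h0 | h1 : (a : ℕ) = 0 ∨ (a : ℕ) = 1 := by omega
    · obtain rfl : a = ⟨0, hr⟩ := Fin.ext h0
      exact (ht.ne_one_and_ne_longest hs2).1
    · obtain rfl : a = ⟨1, hr1⟩ := Fin.ext h1
      rw [hσ]
      exact (ht.longest_mul.ne_one_and_ne_longest hs2).1

/-- Late members (`q ≤ a + 1` with indices from `0`) have trivial block permutation and one
nontrivial mirror pair of blocks, possibly the middle block alone. The early ones have trivial
pieces and inherit irreducibility from `σ_a`. -/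
theorem irreducible_of_irreducibilityCriterion {h : ∑ b, z b = 2 * n + 1}
    (hform : IsInflationForm hr w q σ z β)
    (hz0 : ∀ b, 0 < z b) (hi : ∀ a, IsInfl z h (tilde (w a)) (tilde (σ a)) (β a))
    (hcr : IrreducibilityCriterion hr w q z β) (a : Fin r) : SymmIrreducible (tilde (w a)) := by
  have hz := (hform.symmetric ⟨0, hr⟩).1
  have hlate : q ≤ (a : ℕ) + 1 → SymmIrreducible (tilde (w a)) := by
    intro ha
    have hi1 : IsInfl z h (tilde (w a)) 1 (β a) := by
      have := hi a
      rwa [hform.identity a ha, map_one] at this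
    obtain ⟨b, ⟨hbs, hb⟩, huniq⟩ := hcr.exactly_one a ha
    refine symmIrreducible_of_blockIrreducible hi1 (isSymm_tilde (w a)) hz (b := b) ?_ ?_
    · intro x h1 h2
      by_contra hx
      rcases le_or_rev_le x with hxs | hxs
      · exact h1 (huniq x ⟨hxs, hx⟩)
      · exact h2 (huniq x.rev ⟨hxs, fun e =>
          hx ((isSymmetricFamily_rev_eq_one_iff (hform.symmetric a) x).1 e)⟩)
    · by_cases hbm : (b : ℕ) = s
      · exact (blockIrreducible_iff_symmIrreducible ((rev_eq_self_iff b).2 hbm)).2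
          (irreducibleSymmetric_iff.1 (hcr.middle a b hbm)).2.2
      · exact (blockIrreducible_iff_irreducibleA (mt (rev_eq_self_iff b).1 hbm)).2
          (hcr.outer a b hbm)
  have hearly : (∀ b, β a b = 1) → SymmIrreducible (tilde (σ a)) →
      SymmIrreducible (tilde (w a)) := by
    intro hβ hσ
    have := hi a
    rw [funext hβ] at this
    exact hσ.inflate this hz0 hz
  by_cases hmd : MinusDecomposable (tilde (w ⟨0, hr⟩))
  · obtain ⟨hσ, rfl⟩ := hform.minus_decomposable hmd
    obtain ⟨rfl, hβ⟩ := hcr.minus_decomposable hmd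
    by_cases ha : (a : ℕ) = 0
    · obtain rfl : a = ⟨0, hr⟩ := Fin.ext ha
      refine hearly hβ ?_
      rw [hσ]
      exact symmIrreducible_longest_three
    · exact hlate (by omega)
  · obtain ⟨hs2, hsim, ⟨hr1, hσ⟩, rfl⟩ := hform.minus_indecomposable hmd
    have ht := isSimpleB_iff.1 hsim
    by_cases ha : (a : ℕ) < 2
    · refine hearly (hcr.minus_indecomposable hmd a ha) ?_
      obtain h0 | h1 : (a : ℕ) = 0 ∨ (a : ℕ) = 1 := by omega
      · obtain rfl : a = ⟨0, hr⟩ := Fin.ext h0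
        exact ht.symmIrreducible (ht.ne_one_and_ne_longest hs2).2
      · obtain rfl : a = ⟨1, hr1⟩ := Fin.ext h1
        rw [hσ]
        exact ht.longest_mul.symmIrreducible (ht.longest_mul.ne_one_and_ne_longest hs2).2
    · exact hlate (by omega)

theorem irreducible_iff_irreducibilityCriterion (hform : IsInflationForm hr w q σ z β)
    (hne : ∀ a, (invB (w a)).Nonempty) :
    (∀ a, IrreducibleB (w a)) ↔ IrreducibilityCriterion hr w q z β := by
  obtain ⟨hz0, h, -⟩ := isInflation_iff.1 (hform.inflation ⟨0, hr⟩)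
  have hi : ∀ a, IsInfl z h (tilde (w a)) (tilde (σ a)) (β a) := fun a =>
    (isInflation_iff.1 (hform.inflation a)).2.choose_spec
  simp only [irreducibleB_iff]
  refine ⟨irreducibilityCriterion_of_irreducible hform hz0 hi fun a e => ?_,
    irreducible_of_irreducibilityCriterion hform hz0 hi⟩
  have h1 : w a = 1 := tilde_injective (by rw [e, map_one])
  have := hne a
  rw [h1, invB_one] at this
  exact Set.not_nonempty_empty this

end criterion

end InversionDecomposition

open InversionDecomposition

theorem mainTheorem3 {n r : ℕ} (hn : 1 ≤ n) (w : Fin r → WeylB n)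
    (hdecomp : IsDisjointUnion (posRootsB n) (fun a => invB (w a)))
    (hne : ∀ a, (invB (w a)).Nonempty) :
    ∃ hr : 0 < r,
      (∃ (π : Equiv.Perm (Fin r)) (s q : ℕ) (σ : Fin r → WeylB s) (z : Fin (2 * s + 1) → ℕ)
        (β : Fin r → ∀ b, Equiv.Perm (Fin (z b))),
        IsInflationForm hr (fun a => w (π a)) q σ z β) ∧
      (∀ (π : Equiv.Perm (Fin r)) (s q : ℕ) (σ : Fin r → WeylB s) (z : Fin (2 * s + 1) → ℕ)
        (β : Fin r → ∀ b, Equiv.Perm (Fin (z b))),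
        IsInflationForm hr (fun a => w (π a)) q σ z β →
        ((∀ a, IrreducibleB (w a)) ↔
          IrreducibilityCriterion hr (fun a => w (π a)) q z β)) := by
  have hD := (isDisjointUnion_posRootsB_iff w).1 hdecomp
  have hr : 0 < r := by
    -- As `n ≥ 1`, the root `ε_1` exists and must lie in some member.
    obtain ⟨a, -⟩ := ((isDisjointUnion_iff.1 hdecomp).1 (Pi.single ⟨0, hn⟩ 1)).1
      (Or.inr (Or.inr ⟨_, rfl⟩))
    exact a.pos
  refine ⟨hr, exists_isInflationForm hn w hD hr, fun π s q σ z β hform => ?_⟩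
  rw [← irreducible_iff_irreducibilityCriterion hform fun a => hne (π a)]
  exact (π.forall_congr_right (q := fun a => IrreducibleB (w a))).symm
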